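/- Let $A, B, C$ be complex matrices of sizes $N\times N$, $N\times m$, $p\times N$. They define the linear system $\Sigma$: $\dot x=Ax+Bu$, $y=Cx$, with transfer function $G(s)=C(sI-A)^{-1}B$. Its pole placement map sends an $m\times p$ matrix $K$ to the polynomial $P_\Sigma(K)=\det(sI-(A+BKC))$. The system is symmetric if $p=m$ and $G(s)^T=G(s)$. Two systems of the same sizes are state feedback equivalent if $\widetilde A=L^{-1}(A+BQT^{-1}C)L$, $\widetilde B=L^{-1}BW$ and $\widetilde C=T^{-1}CL$ for some matrix $Q$ and invertible matrices $L,W,T$. Put $V=\mathbb C^{m+p}$. Let $U\subset\wedge^mV$ be the linear span of the lines $\wedge^m\gamma(s)$, where $\gamma(s)\in \mathrm{Gr}_mV$ is the column space of $\binom{I_m}{G(s)}$ (the Hermann–Martin curve). Let $Z\subset\wedge^pV$ be the annihilator of $U$ under the wedge pairing $\wedge^mV\times\wedge^pV\to\wedge^{m+p}V\simeq\mathbb C$. The pole placement map is called proper if $\mathbb P(Z)$ is disjoint from the Grassmannian $\mathrm{Gr}_pV\subset\mathbb P(\wedge^pV)$. The generalized Wronski map with center $\mathbb P(Z)$ is the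 restriction $\pi_Z\colon \mathrm{Gr}_pV\to\mathbb P((\wedge^pV)/Z)$ of the linear projection. When $p=m$, it is called self-adjoint if $Z\supset\theta\wedge(\wedge^{m-2}V)$ for some symplectic form $\omega$ on $V$. Here $\theta\in\wedge^2V$ is the image of $\omega\in\wedge^2V^*$ under the inverse of the isomorphism $V\to V^*$, $u\mapsto\omega(u,\cdot)$, and $\wedge^{m-2}V=0$ if $m<2$. Theorem 3.2. Suppose that $\Sigma$ is controllable and observable, that it is state feedback equivalent to a symmetric system (so $p=m$), and that its pole placement map is proper. Then: 1. The pole placement map is the generalized Wronski map $\pi_Z$. That is, there is an injective linear map $\Phi$ from $(\wedge^mV)/Z$ to the polynomials of degree at most $N$ such that, for every $K\in \mathrm{Mat}_{m\times m}(\mathbb C)$, $\Phi$ sends the line $\pi_Z(H_K)$ to the line spanned by $P_\Sigma(K)$, where $H_K\in \mathrm{Gr}_mV$ is the column space of $\binom{K}{I_m}$. 2. This generalized Wronski map is self-adjoint: $Z\supset\theta\wedge(\wedge^{m-2}V)$ for some symplectic form on $V$. 3. If $m\ge2$, then $\pi_Z$ has finite even degree over its image. The degree is that of the function field of $\mathrm{Gr}_mV$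 as an extension of the function field of the image. -/

import Mathlib

open scoped ExteriorAlgebra

noncomputable section

/-- A state-space realization `(A, B, C)` over `ℂ` of a strictly proper linear system
`x' = A x + B u`, `y = C x` with `m` inputs, `p` outputs and `N` states. -/
structure LinearSystem (N m p : ℕ) where
  A : Matrix (Fin N) (Fin N) ℂ
  B : Matrix (Fin N) (Fin m) ℂ
  C : Matrix (Fin p) (Fin N) ℂ

namespace LinearSystem

variable {N m p : ℕ}

/-- Controllability: the matrix `[B, A B, …, A ^ (N - 1) B]` has full rank `N`. -/
def IsControllable (S : LinearSystem N m p) : Prop :=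
  (Matrix.of fun (i : Fin N) (kj : Fin N × Fin m) => (S.A ^ (kj.1 : ℕ) * S.B) i kj.2).rank = N

/-- Observability: the matrix with block rows `C, C A, …, C A ^ (N - 1)` has full rank `N`. -/
def IsObservable (S : LinearSystem N m p) : Prop :=
  (Matrix.of fun (ki : Fin N × Fin p) (j : Fin N) => (S.C * S.A ^ (ki.1 : ℕ)) ki.2 j).rank = N

/-- `s` is a regular point of the transfer function: `s I - A` is invertible. All but finitely many
complex numbers are regular. -/
def IsRegularPoint (S : LinearSystem N m p) (s : ℂ) : Prop :=
  IsUnit (Matrix.scalar (Fin N) s - S.A).det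

/-- The transfer function `G(s) = C (s I - A)⁻¹ B`, used at regular points `s` only. -/
def transfer (S : LinearSystem N m p) (s : ℂ) : Matrix (Fin p) (Fin m) ℂ :=
  S.C * (Matrix.scalar (Fin N) s - S.A)⁻¹ * S.B

/-- A system with as many inputs as outputs is symmetric if `G(s)ᵀ = G(s)`. (An identity of rational
functions, equivalently an identity at all points where `s I - A` is invertible.) -/
def IsSymmetric (S : LinearSystem N m m) : Prop :=
  ∀ s : ℂ, S.IsRegularPoint s → (S.transfer s).transpose = S.transfer s

/-- State feedback equivalence of realizations:
`A' = L⁻¹ (A + B Q T⁻¹ C) L`, `B' = L⁻¹ B W`, `C' = T⁻¹ C L`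
with `L`, `W`, `T` invertible and `Q` arbitrary. -/
def StateFeedbackEquiv (S S' : LinearSystem N m p) : Prop :=
  ∃ (L : Matrix (Fin N) (Fin N) ℂ) (W : Matrix (Fin m) (Fin m) ℂ)
    (T : Matrix (Fin p) (Fin p) ℂ) (Q : Matrix (Fin m) (Fin p) ℂ),
    IsUnit L.det ∧ IsUnit W.det ∧ IsUnit T.det ∧
      S'.A = L⁻¹ * (S.A + S.B * Q * T⁻¹ * S.C) * L ∧
      S'.B = L⁻¹ * S.B * W ∧
      S'.C = T⁻¹ * S.C * L

/-- The pole placement map `K ↦ det (s I - (A + B K C))`. -/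
def polePlacement (S : LinearSystem N m p) (K : Matrix (Fin m) (Fin p) ℂ) : Polynomial ℂ :=
  (S.A + S.B * K * S.C).charpoly

end LinearSystem

/-- The space `ℂ^{m+p}`, with its coordinates split into the first `m` and the last `p`. -/
abbrev SplitSpace (m p : ℕ) : Type := Fin m ⊕ Fin p → ℂ

/-- The Grassmannian `Gr_k V` of `k`-dimensional linear subspaces of `V`. -/
def Gr (k : ℕ) (V : Type) [AddCommGroup V] [Module ℂ V] : Type :=
  {H : Submodule ℂ V // Module.finrank ℂ H = k}

/-- The Plücker embedding `H ↦ ∧ᵏ H`, where a point of a projective space `ℙ(W)` is a line in `W`: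
`∧ᵏ H` is the image of the `k`-th exterior power of the inclusion `H → V`. -/
def pluckerLine {k : ℕ} {V : Type} [AddCommGroup V] [Module ℂ V] (H : Gr k V) :
    Submodule ℂ (⋀[ℂ]^k V) :=
  LinearMap.range (exteriorPower.map k H.1.subtype)

/-- `ℙ(Z)` is disjoint from the Grassmannian in the Plücker space `ℙ(∧ᵏ V)`. -/
def DisjointFromGr {k : ℕ} {V : Type} [AddCommGroup V] [Module ℂ V]
    (Z : Submodule ℂ (⋀[ℂ]^k V)) : Prop :=
  ∀ H : Gr k V, ¬ pluckerLine H ≤ Z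

/-- The generalized Wronski map `π_Z` with center `ℙ(Z)`: the restriction to `Gr_k V` of the linear
projection `ℙ(∧ᵏ V) ⇢ ℙ((∧ᵏ V) / Z)`. Its value is a line whenever `ℙ(Z)` does not contain the
Plücker point of `H`. -/
def wronskiMap {k : ℕ} {V : Type} [AddCommGroup V] [Module ℂ V]
    (Z : Submodule ℂ (⋀[ℂ]^k V)) (H : Gr k V) : Submodule ℂ ((⋀[ℂ]^k V) ⧸ Z) :=
  (pluckerLine H).map Z.mkQ

section Chart

variable {m p : ℕ}

/-- The matrix `(K; I_p)` of size `(m + p) × p`. -/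
def chartMatrix (K : Matrix (Fin m) (Fin p) ℂ) : Matrix (Fin m ⊕ Fin p) (Fin p) ℂ :=
  Matrix.fromRows K 1

theorem chartMatrix_mulVec_injective (K : Matrix (Fin m) (Fin p) ℂ) :
    Function.Injective (chartMatrix K).mulVecLin := by
  intro x y h
  ext i
  have := congrFun h (Sum.inr i)
  simpa [chartMatrix, Matrix.fromRows_mulVec] using this

/-- The affine chart `Mat_{m × p} → Gr_p ℂ^{m+p}` that sends `K` to the column space
of `(K; I_p)`. Its image is a dense open subset of the Grassmannian. -/
def chart (K : Matrix (Fin m) (Fin p) ℂ) : Gr p (SplitSpace m p) :=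
  ⟨LinearMap.range (chartMatrix K).mulVecLin, by
    rw [LinearMap.finrank_range_of_inj (chartMatrix_mulVec_injective K)]
    simp⟩

/-- The wedge product in `∧ᵖ ℂ^{m+p}` of the columns of `(K; I_p)`. It spans the line
`∧ᵖ (chart K)`. -/
def chartVector (K : Matrix (Fin m) (Fin p) ℂ) : ⋀[ℂ]^p (SplitSpace m p) :=
  exteriorPower.ιMulti ℂ p fun j => (chartMatrix K).transpose j

/-- The function field of `Gr_p ℂ^{m+p}`, which is the field of rational functions on its affine chart
of `m × p` matrices. -/
abbrev GrFunctionField (m p : ℕ) : Type := FractionRing (MvPolynomial (Fin m × Fin p) ℂ)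

/-- The polynomial `a` in the entries of `K` is the restriction to the affine chart of the
homogeneous linear coordinate `l` on the target `ℙ((∧ᵖ ℂ^{m+p}) / Z)` of `π_Z`. -/
def IsPullback (Z : Submodule ℂ (⋀[ℂ]^p (SplitSpace m p)))
    (l : Module.Dual ℂ ((⋀[ℂ]^p (SplitSpace m p)) ⧸ Z))
    (a : MvPolynomial (Fin m × Fin p) ℂ) : Prop :=
  ∀ K : Matrix (Fin m) (Fin p) ℂ,
    MvPolynomial.eval (fun ij => K ij.1 ij.2) a = l (Z.mkQ (chartVector K))

/-- The function field of the image of `π_Z`, as a subfield of the function field of `Gr_p ℂ^{m+p}`.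
It is generated over `ℂ` by the pullbacks of the quotients `l₁ / l₂` of homogeneous linear coordinates
on the target, where `l₂` does not vanish identically on the image. -/
def imageFunctionField (Z : Submodule ℂ (⋀[ℂ]^p (SplitSpace m p))) :
    IntermediateField ℂ (GrFunctionField m p) :=
  IntermediateField.adjoin ℂ
    {f | ∃ (l₁ l₂ : Module.Dual ℂ ((⋀[ℂ]^p (SplitSpace m p)) ⧸ Z))
        (a b : MvPolynomial (Fin m × Fin p) ℂ),
      IsPullback Z l₁ a ∧ IsPullback Z l₂ b ∧ b ≠ 0 ∧
        f = algebraMap _ (GrFunctionField m p) a / algebraMap _ (GrFunctionField m p) b}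

/-- `π_Z` has degree `d` over its image: the function field of `Gr_p ℂ^{m+p}` is a finite extension of
degree `d` of the function field of the image of `π_Z`. -/
def WronskiMapHasDegree (Z : Submodule ℂ (⋀[ℂ]^p (SplitSpace m p))) (d : ℕ) : Prop :=
  FiniteDimensional (imageFunctionField Z) (GrFunctionField m p) ∧
    Module.finrank (imageFunctionField Z) (GrFunctionField m p) = d

end Chart

namespace LinearSystem

variable {N m p : ℕ}

/-- The Plücker vector in `∧ᵐ ℂ^{m+p}` of the point `γ(s)` of the Hermann-Martin curve: the wedge
product of the columns of `(I_m; G(s))`. -/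
def hermannMartinVector (S : LinearSystem N m p) (s : ℂ) : ⋀[ℂ]^m (SplitSpace m p) :=
  exteriorPower.ιMulti ℂ m fun j => (Matrix.fromRows (1 : Matrix (Fin m) (Fin m) ℂ)
    (S.transfer s)).transpose j

/-- The linear span `U` in `∧ᵐ ℂ^{m+p}` of the Hermann-Martin curve. The points of the curve at `∞` and
at the poles are limits of points at regular `s`. As linear subspaces are closed, these finitely many
points do not enlarge the span. -/
def hermannMartinSpan (S : LinearSystem N m p) : Submodule ℂ (⋀[ℂ]^m (SplitSpace m p)) :=
  Submodule.span ℂ {α | ∃ s : ℂ, S.IsRegularPoint s ∧ α = S.hermannMartinVector s}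

/-- The center `Z = U^⊥` of the pole placement map: the annihilator of `U` in `∧ᵖ ℂ^{m+p}` under
the perfect pairing `∧ᵐ ℂ^{m+p} × ∧ᵖ ℂ^{m+p} → ∧^{m+p} ℂ^{m+p} ≃ ℂ` given by
the wedge product. -/
def center (S : LinearSystem N m p) : Submodule ℂ (⋀[ℂ]^p (SplitSpace m p)) where
  carrier := {β | ∀ α ∈ S.hermannMartinSpan,
    (α : ExteriorAlgebra ℂ (SplitSpace m p)) * (β : ExteriorAlgebra ℂ (SplitSpace m p)) = 0}
  add_mem' := fun {x y} hx hy α hα => by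
    rw [Submodule.coe_add, mul_add, hx α hα, hy α hα, add_zero]
  zero_mem' := fun α _ => by rw [Submodule.coe_zero, mul_zero]
  smul_mem' := fun c x hx α hα => by
    rw [Submodule.coe_smul, mul_smul_comm, hx α hα, smul_zero]

/-- The pole placement map is proper if `ℙ(Z)` is disjoint from the Grassmannian `Gr_p ℂ^{m+p}`. -/
def IsProper (S : LinearSystem N m p) : Prop := DisjointFromGr S.center

/-- The pole placement map `K ↦ P(K)` is the generalized Wronski map `π_Z`, where `Mat_{m × p}` is
identified with an open subset of `Gr_p ℂ^{m+p}` through `chart`, and the target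
`ℙ((∧ᵖ ℂ^{m+p}) / Z)` is linearly embedded in the projective space of polynomials
of degree at most `N`. -/
def PolePlacementIsWronskiMap (S : LinearSystem N m p)
    (Z : Submodule ℂ (⋀[ℂ]^p (SplitSpace m p))) : Prop :=
  ∃ Φ : ((⋀[ℂ]^p (SplitSpace m p)) ⧸ Z) →ₗ[ℂ] Polynomial ℂ,
    Function.Injective Φ ∧
    LinearMap.range Φ ≤ Polynomial.degreeLE ℂ (N : WithBot ℕ) ∧
    ∀ K : Matrix (Fin m) (Fin p) ℂ,
      (wronskiMap Z (chart K)).map Φ = Submodule.span ℂ {S.polePlacement K}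

end LinearSystem

section Symplectic

variable {ι : Type} [Fintype ι] [DecidableEq ι]

/-- An alternating bilinear form `ω` on `ℂ^ι` as an element of `∧² V*`, namely
`∑_{i<j} ω(e_i, e_j) e_i* ∧ e_j*`, which is half of the sum over all `i` and `j`. -/
def alternatingTensor (ω : LinearMap.BilinForm ℂ (ι → ℂ)) :
    ExteriorAlgebra ℂ (Module.Dual ℂ (ι → ℂ)) :=
  (1 / 2 : ℂ) • ∑ i : ι, ∑ j : ι, ω (Pi.single i 1) (Pi.single j 1) •
    (ExteriorAlgebra.ι ℂ (LinearMap.proj i : Module.Dual ℂ (ι → ℂ)) *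
      ExteriorAlgebra.ι ℂ (LinearMap.proj j : Module.Dual ℂ (ι → ℂ)))

/-- The dual form `θ = ψ(ω)` in `∧² V` of a symplectic form `ω`, where `ψ : V* → V` is the inverse of the
isomorphism `u ↦ ω(u, ·)`. -/
def dualForm (ω : LinearMap.BilinForm ℂ (ι → ℂ)) (hω : ω.Nondegenerate) :
    ExteriorAlgebra ℂ (ι → ℂ) :=
  ExteriorAlgebra.map (ω.toDual hω).symm.toLinearMap (alternatingTensor ω)

/-- The subspace `θ ∧ ∧^{m-2} V` of `∧ᵐ V`, which is zero for `m < 2`. -/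
def dualFormWedge (m : ℕ) (ω : LinearMap.BilinForm ℂ (ι → ℂ)) (hω : ω.Nondegenerate) :
    Submodule ℂ (⋀[ℂ]^m (ι → ℂ)) :=
  Submodule.span ℂ {x | ∃ k : ℕ, k + 2 = m ∧ ∃ β : ⋀[ℂ]^k (ι → ℂ),
    (x : ExteriorAlgebra ℂ (ι → ℂ)) = dualForm ω hω * (β : ExteriorAlgebra ℂ (ι → ℂ))}

/-- A generalized Wronski map on `Gr_m V` with center `ℙ(Z)` is self-adjoint if `Z` contains
`θ ∧ ∧^{m-2} V` for some symplectic form (nondegenerate alternating bilinear form) on `V`. -/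
def IsSelfAdjointCenter {m : ℕ} (Z : Submodule ℂ (⋀[ℂ]^m (ι → ℂ))) : Prop :=
  ∃ (ω : LinearMap.BilinForm ℂ (ι → ℂ)) (hω : ω.Nondegenerate),
    ω.IsAlt ∧ dualFormWedge m ω hω ≤ Z

end Symplectic

end

noncomputable section

/-! Everything rests on the Rosenbrock determinant, the determinant of `[[s - A, B M₁], [C, M₂]]`.
It is alternating in the columns of `M = (M₁; M₂)`, so it defines a linear map from `∧ᵖ V` to
polynomials in `s`, and at `M = (K; 1)` it equals the pole placement polynomial of `K`. A Schur
complement shows that its value at a regular `s` is `det (s - A)` times the wedge with `γ(s)`. Hence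
its kernel is exactly `Z` (`ker_polePlacementLinear`), which gives the first claim.

For a symmetric system `γ(s)` is Lagrangian for the standard symplectic form. State feedback moves
the curve by the constant matrix `[[W, Q], [0, T]]`, so the curve of `S` is Lagrangian for the
transported form. If `hⱼ, gⱼ` is a symplectic basis with all `hⱼ` in `γ(s)`, then `θ = ∑ hⱼ ∧ gⱼ` is
annihilated by the Plücker vector of `γ(s)` (`isSelfAdjointCenter_center`).

Transposing `K` preserves the poles of a symmetric system. Transported to `S`, this is an involution
of the chart that fixes the function field of the image and is nontrivial for `m ≥ 2`, so the degree
is even once it is finite. Finiteness comes from properness through valuations: a valuation ring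
containing the coefficients of the generic pole placement polynomial also contains the entries of
`K` (`IsProper.mem_valuationSubring`), so these entries are integral over the image field. -/

/-! ### Exterior powers and Plücker lines -/

theorem AlternatingMap.map_eq_det_smul {R M N ι : Type*} [CommRing R] [AddCommGroup M] [Module R M]
    [AddCommGroup N] [Module R N] [Fintype ι] [DecidableEq ι]
    (f : M [⋀^ι]→ₗ[R] N) (b : Module.Basis ι R M) (v : ι → M) :
    f v = b.det v • f b := by
  have h : f = (LinearMap.toSpanSingleton R N (f b)).compAlternatingMap b.det := by
    refine Module.Basis.ext_alternating b fun i hi => ?_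
    let σ : Equiv.Perm ι := Equiv.ofBijective i (Finite.injective_iff_bijective.1 hi)
    have h1 : f (fun j => b (i j)) = Equiv.Perm.sign σ • f b := f.map_perm b σ
    have h2 : b.det (fun j => b (i j)) = Equiv.Perm.sign σ • b.det b := b.det.map_perm b σ
    simp only [LinearMap.compAlternatingMap_apply, LinearMap.toSpanSingleton_apply]
    rw [h1, h2, Module.Basis.det_self, Units.smul_def, Units.smul_def, zsmul_one, Int.cast_smul_eq_zsmul]
  exact DFunLike.congr_fun h v

theorem exteriorPower.span_ιMulti_basis {R M : Type*} [CommRing R] [AddCommGroup M] [Module R M]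
    {n : ℕ} (b : Module.Basis (Fin n) R M) :
    Submodule.span R {exteriorPower.ιMulti R n b} = ⊤ := by
  rw [eq_top_iff, ← exteriorPower.ιMulti_span, Submodule.span_le]
  rintro _ ⟨v, rfl⟩
  rw [AlternatingMap.map_eq_det_smul (exteriorPower.ιMulti R n) b v]
  exact Submodule.smul_mem _ _ (Submodule.mem_span_singleton_self _)

/-- The determinant of the basis, extended to the exterior algebra, takes the value 1 on this wedge.
-/
theorem ExteriorAlgebra.ιMulti_basis_ne_zero {R M : Type*} [CommRing R] [Nontrivial R]
    [AddCommGroup M] [Module R M] {n : ℕ} (b : Module.Basis (Fin n) R M) :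
    ExteriorAlgebra.ιMulti R n b ≠ 0 := by
  intro h
  have := congrArg (ExteriorAlgebra.liftAlternating (R := R) (Pi.single n b.det)) h
  rw [ExteriorAlgebra.liftAlternating_apply_ιMulti, map_zero, Pi.single_eq_same,
    Module.Basis.det_self] at this
  exact one_ne_zero this

theorem pluckerLine_eq_span {k : ℕ} {V : Type} [AddCommGroup V] [Module ℂ V] (H : Gr k V)
    (v : Fin k → V) (hv : LinearIndependent ℂ v) (hH : Submodule.span ℂ (Set.range v) = H.1) :
    pluckerLine H = Submodule.span ℂ {exteriorPower.ιMulti ℂ k v} := by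
  obtain ⟨H, hk⟩ := H
  dsimp only at hH
  subst hH
  have hb : (Submodule.subtype _) ∘ (Module.Basis.span hv) = v := by
    ext i; simp [Module.Basis.span_apply]
  change LinearMap.range (exteriorPower.map k (Submodule.subtype _)) = _
  rw [LinearMap.range_eq_map, ← exteriorPower.span_ιMulti_basis (Module.Basis.span hv),
    Submodule.map_span, Set.image_singleton, exteriorPower.map_apply_ιMulti, hb]

theorem pluckerLine_chart {m p : ℕ} (K : Matrix (Fin m) (Fin p) ℂ) :
    pluckerLine (chart K) = Submodule.span ℂ {chartVector K} := by
  refine pluckerLine_eq_span _ _ ?_ ?_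
  · exact Matrix.mulVec_injective_iff.1 (chartMatrix_mulVec_injective K)
  · exact (Matrix.range_mulVecLin _).symm

theorem ExteriorAlgebra.ιMulti_mul_ι_of_mem_span {R M : Type*} [CommRing R]
    [AddCommGroup M] [Module R M] {n : ℕ} (v : Fin n → M) {x : M}
    (hx : x ∈ Submodule.span R (Set.range v)) :
    ExteriorAlgebra.ιMulti R n v * ExteriorAlgebra.ι R x = 0 := by
  induction hx using Submodule.span_induction with
  | mem x hx =>
    obtain ⟨i, rfl⟩ := hx
    have h1 : ExteriorAlgebra.ι R (v i) = ExteriorAlgebra.ιMulti R 1 (fun _ => v i) := by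
      simp [ExteriorAlgebra.ιMulti_apply]
    rw [h1, ExteriorAlgebra.ιMulti_mul_ιMulti]
    refine AlternatingMap.map_eq_zero_of_eq _ _ (i := Fin.castAdd 1 i) (j := Fin.natAdd n 0) ?_ ?_
    · simp
    · intro h
      have := congrArg Fin.val h
      simp at this
      omega
  | zero => simp
  | add x y _ _ hx hy => rw [map_add, mul_add, hx, hy, add_zero]
  | smul a x _ hx => rw [map_smul, mul_smul_comm, hx, smul_zero]

/-! ### The Rosenbrock determinant -/

namespace LinearSystem

open Polynomial

variable {N m p : ℕ}

/-- The Rosenbrock matrix `[[X - A, B M₁], [C, M₂]]` for a matrix `M = (M₁; M₂)` with entries in a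
`ℂ`-algebra `R`. -/
def rosenbrock (S : LinearSystem N m p) {R : Type*} [CommRing R] [Algebra ℂ R]
    (M : Matrix (Fin m ⊕ Fin p) (Fin p) R) : Matrix (Fin N ⊕ Fin p) (Fin N ⊕ Fin p) R[X] :=
  Matrix.fromBlocks (S.A.map (algebraMap ℂ R)).charmatrix
    ((S.B.map (algebraMap ℂ R) * M.toRows₁).map Polynomial.C)
    (S.C.map (fun c => Polynomial.C (algebraMap ℂ R c)))
    (M.toRows₂.map Polynomial.C)

theorem rosenbrock_inl_inr (S : LinearSystem N m p) {R : Type*} [CommRing R] [Algebra ℂ R]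
    (M : Matrix (Fin m ⊕ Fin p) (Fin p) R) (i : Fin N) (j : Fin p) :
    S.rosenbrock M (Sum.inl i) (Sum.inr j) =
      Polynomial.C (∑ k, algebraMap ℂ R (S.B i k) * M (Sum.inl k) j) := rfl

theorem rosenbrock_inr_inr (S : LinearSystem N m p) {R : Type*} [CommRing R] [Algebra ℂ R]
    (M : Matrix (Fin m ⊕ Fin p) (Fin p) R) (i j : Fin p) :
    S.rosenbrock M (Sum.inr i) (Sum.inr j) = Polynomial.C (M (Sum.inr i) j) := rfl

theorem natDegree_charmatrix_le {R : Type*} [CommRing R] (A : Matrix (Fin N) (Fin N) R)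
    (i j : Fin N) : (A.charmatrix i j).natDegree ≤ 1 := by
  nontriviality R
  by_cases h : i = j
  · subst h
    rw [Matrix.charmatrix_apply_eq]
    exact (Polynomial.natDegree_X_sub_C_le _)
  · rw [Matrix.charmatrix_apply_ne _ _ _ h, natDegree_neg, natDegree_C]
    exact zero_le_one

/-- In the Leibniz expansion only the first `N` columns involve `X`, each with degree at most 1. -/
theorem natDegree_det_rosenbrock_le (S : LinearSystem N m p) {R : Type*} [CommRing R] [Algebra ℂ R]
    (M : Matrix (Fin m ⊕ Fin p) (Fin p) R) : (S.rosenbrock M).det.natDegree ≤ N := by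
  rw [Matrix.det_apply]
  refine Polynomial.natDegree_sum_le_of_forall_le _ _ fun σ _ => ?_
  refine (Polynomial.natDegree_smul_le _ _).trans ?_
  refine (Polynomial.natDegree_prod_le _ _).trans ?_
  rw [Fintype.sum_sum_type]
  have h1 : ∀ i : Fin N, (S.rosenbrock M (σ (Sum.inl i)) (Sum.inl i)).natDegree ≤ 1 := by
    intro i
    rcases σ (Sum.inl i) with j | j
    · exact natDegree_charmatrix_le _ _ _
    · simp [rosenbrock]
  have h2 : ∀ i : Fin p, (S.rosenbrock M (σ (Sum.inr i)) (Sum.inr i)).natDegree = 0 := by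
    intro i
    rcases σ (Sum.inr i) with j | j
    · rw [rosenbrock_inl_inr, natDegree_C]
    · rw [rosenbrock_inr_inr, natDegree_C]
  rw [Finset.sum_eq_zero (fun i _ => h2 i), add_zero]
  exact (Finset.sum_le_sum fun i _ => h1 i).trans (by simp)

/-- Naturality in the coefficient ring lets the generic matrix over a polynomial ring be specialized
to complex matrices and to matrices over a field with a valuation. -/
theorem map_det_rosenbrock (S : LinearSystem N m p) {R R' : Type*} [CommRing R] [Algebra ℂ R]
    [CommRing R'] [Algebra ℂ R'] (f : R →ₐ[ℂ] R') (M : Matrix (Fin m ⊕ Fin p) (Fin p) R) :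
    (S.rosenbrock M).det.map (f : R →+* R') = (S.rosenbrock (M.map f)).det := by
  rw [← Polynomial.coe_mapRingHom, RingHom.map_det]
  congr 1
  ext1 i j
  rcases i with i | i <;> rcases j with j | j
  · by_cases h : i = j
    · subst h; simp [rosenbrock, Matrix.charmatrix_apply_eq]
    · simp [rosenbrock, Matrix.charmatrix_apply_ne _ _ _ h]
  · simp only [RingHom.mapMatrix_apply, Matrix.map_apply, rosenbrock_inl_inr, coe_mapRingHom, map_C]
    simp
  · simp [rosenbrock]
  · simp [rosenbrock]

/-- A change of basis of the column space is right multiplication of the Rosenbrock matrix by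
`diag(1, T)`. This is the homogeneity used to move between charts of the Grassmannian. -/
theorem det_rosenbrock_mul (S : LinearSystem N m p) {R : Type*} [CommRing R] [Algebra ℂ R]
    (M : Matrix (Fin m ⊕ Fin p) (Fin p) R) (T : Matrix (Fin p) (Fin p) R) :
    (S.rosenbrock (M * T)).det = (S.rosenbrock M).det * Polynomial.C T.det := by
  have h : S.rosenbrock (M * T) =
      S.rosenbrock M * Matrix.fromBlocks 1 0 0 (T.map Polynomial.C) := by
    have h1 : (M * T).toRows₁ = M.toRows₁ * T := rfl
    have h2 : (M * T).toRows₂ = M.toRows₂ * T := rfl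
    simp only [rosenbrock, Matrix.fromBlocks_multiply, Matrix.mul_one, Matrix.mul_zero, add_zero,
      zero_add, h1, h2, ← Matrix.mul_assoc, Matrix.map_mul]
  rw [h, Matrix.det_mul, Matrix.det_fromBlocks_zero₂₁, Matrix.det_one, one_mul, RingHom.map_det]
  rfl

theorem det_rosenbrock_fromRows_one (S : LinearSystem N m p) {R : Type*} [CommRing R] [Algebra ℂ R]
    (K : Matrix (Fin m) (Fin p) R) :
    (S.rosenbrock (Matrix.fromRows K 1)).det =
      (S.A.map (algebraMap ℂ R) + S.B.map (algebraMap ℂ R) * K *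
        S.C.map (algebraMap ℂ R)).charpoly := by
  rw [rosenbrock, Matrix.toRows₁_fromRows, Matrix.toRows₂_fromRows,
    Matrix.map_one _ (map_zero _) (map_one _),
    Matrix.det_fromBlocks_one₂₂, Matrix.charpoly]
  congr 1
  rw [Matrix.charmatrix, Matrix.charmatrix, map_add, sub_sub]
  congr 2
  ext1 i j
  simp [Matrix.mul_apply]

theorem det_rosenbrock_chartMatrix (S : LinearSystem N m p) (K : Matrix (Fin m) (Fin p) ℂ) :
    (S.rosenbrock (chartMatrix K)).det = S.polePlacement K := by
  rw [chartMatrix, det_rosenbrock_fromRows_one, polePlacement]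
  congr 1

theorem eval_det_rosenbrock (S : LinearSystem N m p) {s : ℂ} (hs : S.IsRegularPoint s)
    (M : Matrix (Fin m ⊕ Fin p) (Fin p) ℂ) :
    (S.rosenbrock M).det.eval s = (Matrix.scalar (Fin N) s - S.A).det *
      (Matrix.fromBlocks 1 M.toRows₁ (S.transfer s) M.toRows₂).det := by
  have h : (S.rosenbrock M).map (Polynomial.eval s) =
      Matrix.fromBlocks (Matrix.scalar (Fin N) s - S.A) (S.B * M.toRows₁) S.C M.toRows₂ := by
    ext1 i j
    rcases i with i | i <;> rcases j with j | j
    · by_cases h : i = j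
      · subst h; simp [rosenbrock, Matrix.charmatrix_apply_eq]
      · simp [rosenbrock, h]
    · rw [Matrix.map_apply, rosenbrock_inl_inr, eval_C]
      simp [Matrix.mul_apply]
    · simp [rosenbrock]
    · simp [rosenbrock]
  rw [← Polynomial.coe_evalRingHom, RingHom.map_det, RingHom.mapMatrix_apply,
    Polynomial.coe_evalRingHom, h]
  let := Matrix.invertibleOfIsUnitDet _ hs
  rw [Matrix.det_fromBlocks₁₁, Matrix.det_fromBlocks_one₁₁, transfer, Matrix.invOf_eq_nonsing_inv]
  simp only [Matrix.mul_assoc]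

/-- The column of the Rosenbrock matrix that comes from a column `x` of `M`. -/
def rosenbrockColumn (S : LinearSystem N m p) :
    SplitSpace m p →ₗ[ℂ] (Fin N ⊕ Fin p → ℂ[X]) where
  toFun x := Sum.elim (fun k => Polynomial.C (∑ j, S.B k j * x (Sum.inl j)))
    (fun k => Polynomial.C (x (Sum.inr k)))
  map_add' x y := by
    ext1 (k | k)
    · simp only [Pi.add_apply, Sum.elim_inl, mul_add, Finset.sum_add_distrib, map_add]
    · simp
  map_smul' c x := by
    ext1 (k | k)
    · simp only [Pi.smul_apply, Sum.elim_inl, smul_eq_mul, mul_left_comm _ c, ← Finset.mul_sum,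
        RingHom.id_apply, smul_eq_C_mul, map_mul]
    · simp [smul_eq_C_mul]

theorem rosenbrock_update (S : LinearSystem N m p) (v : Fin p → SplitSpace m p) (i : Fin p)
    (z : SplitSpace m p) :
    S.rosenbrock (Matrix.of (Function.update v i z)).transpose =
      (S.rosenbrock (Matrix.of v).transpose).updateCol (Sum.inr i) (S.rosenbrockColumn z) := by
  ext1 a (b | b)
  · rw [Matrix.updateCol_ne (by simp)]
    rcases a with a | a <;> rfl
  · by_cases hb : b = i
    · subst hb
      rw [Matrix.updateCol_self]
      rcases a with a | a <;> simp [rosenbrock_inl_inr, rosenbrock_inr_inr, rosenbrockColumn]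
    · rw [Matrix.updateCol_ne (by simpa using hb)]
      rcases a with a | a <;> simp [rosenbrock_inl_inr, rosenbrock_inr_inr, hb]

/-- The determinant of the Rosenbrock matrix as an alternating function of the columns. -/
def rosenbrockAlternating (S : LinearSystem N m p) : (SplitSpace m p) [⋀^Fin p]→ₗ[ℂ] ℂ[X] where
  toFun v := (S.rosenbrock (Matrix.of v).transpose).det
  map_update_add' := by
    intro inst v i x y
    obtain rfl : inst = instDecidableEqFin p := Subsingleton.elim _ _
    rw [rosenbrock_update, rosenbrock_update, rosenbrock_update, map_add, Matrix.det_updateCol_add]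
  map_update_smul' := by
    intro inst v i c x
    obtain rfl : inst = instDecidableEqFin p := Subsingleton.elim _ _
    rw [rosenbrock_update, rosenbrock_update, map_smul, (by
      ext1; simp [smul_eq_C_mul] : c • S.rosenbrockColumn x = Polynomial.C c • S.rosenbrockColumn x),
      Matrix.det_updateCol_smul, smul_eq_C_mul]
  map_eq_zero_of_eq' := by
    intro v i j hv hij
    refine Matrix.det_zero_of_column_eq (i := Sum.inr i) (j := Sum.inr j) (by simpa using hij) ?_
    intro k
    rcases k with k | k <;> simp [rosenbrock_inl_inr, rosenbrock_inr_inr, hv]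

/-! ### The center as the kernel of the linearized pole placement map -/

variable {N m p : ℕ}

theorem isRegularPoint_iff (S : LinearSystem N m p) (s : ℂ) :
    S.IsRegularPoint s ↔ S.A.charpoly.eval s ≠ 0 := by
  rw [IsRegularPoint, Matrix.eval_charpoly, isUnit_iff_ne_zero]

theorem finite_setOf_not_isRegularPoint (S : LinearSystem N m p) :
    {s | ¬ S.IsRegularPoint s}.Finite := by
  refine (S.A.charpoly.roots.toFinset.finite_toSet).subset fun s hs => ?_
  rw [Set.mem_ofPred_eq, isRegularPoint_iff, not_not] at hs
  simpa [Polynomial.mem_roots (Matrix.charpoly_monic S.A).ne_zero] using hs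

/-- The linear map `∧ᵖ V → ℂ[s]` which induces the pole placement map on the Grassmannian. -/
def polePlacementLinear (S : LinearSystem N m p) : ⋀[ℂ]^p (SplitSpace m p) →ₗ[ℂ] ℂ[X] :=
  exteriorPower.alternatingMapLinearEquiv S.rosenbrockAlternating

theorem polePlacementLinear_ιMulti (S : LinearSystem N m p) (v : Fin p → SplitSpace m p) :
    S.polePlacementLinear (exteriorPower.ιMulti ℂ p v) =
      (S.rosenbrock (Matrix.of v).transpose).det :=
  exteriorPower.alternatingMapLinearEquiv_apply_ιMulti _ _

theorem polePlacementLinear_columns (S : LinearSystem N m p)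
    (M : Matrix (Fin m ⊕ Fin p) (Fin p) ℂ) :
    S.polePlacementLinear (exteriorPower.ιMulti ℂ p fun j => M.transpose j) =
      (S.rosenbrock M).det :=
  S.polePlacementLinear_ιMulti _

theorem polePlacementLinear_chartVector (S : LinearSystem N m p) (K : Matrix (Fin m) (Fin p) ℂ) :
    S.polePlacementLinear (chartVector K) = S.polePlacement K := by
  rw [chartVector, polePlacementLinear_columns, det_rosenbrock_chartMatrix]

theorem range_polePlacementLinear_le (S : LinearSystem N m p) :
    LinearMap.range S.polePlacementLinear ≤ Polynomial.degreeLE ℂ (N : WithBot ℕ) := by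
  rw [LinearMap.range_eq_map, ← exteriorPower.ιMulti_span, Submodule.map_span, Submodule.span_le]
  rintro _ ⟨_, ⟨v, rfl⟩, rfl⟩
  rw [polePlacementLinear_ιMulti, SetLike.mem_coe, Polynomial.mem_degreeLE]
  exact Polynomial.degree_le_of_natDegree_le (S.natDegree_det_rosenbrock_le _)

/-- The standard basis of `ℂ^{m+p}`, indexed by `Fin (m + p)`. -/
def splitBasis (m p : ℕ) : Module.Basis (Fin (m + p)) ℂ (SplitSpace m p) :=
  (Pi.basisFun ℂ (Fin m ⊕ Fin p)).reindex finSumFinEquiv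

theorem splitBasis_det_append (a : Matrix (Fin m ⊕ Fin p) (Fin m) ℂ)
    (v : Fin p → SplitSpace m p) :
    (splitBasis m p).det (Fin.append (fun j => a.transpose j) v) =
      (Matrix.fromCols a (Matrix.of v).transpose).det := by
  rw [Module.Basis.det_apply, ← Matrix.det_submatrix_equiv_self finSumFinEquiv]
  congr 1
  ext1 i j
  rcases j with j | j <;> simp [splitBasis, Module.Basis.toMatrix_apply]

/-- On decomposable `β` the wedge is the determinant of the columns of `(1; G(s))` followed by those
of `β`. The Schur complement `eval_det_rosenbrock` relates it to the Rosenbrock determinant, and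
linearity does the rest. -/
theorem smul_hermannMartinVector_mul (S : LinearSystem N m p) {s : ℂ} (hs : S.IsRegularPoint s)
    (β : ⋀[ℂ]^p (SplitSpace m p)) :
    (Matrix.scalar (Fin N) s - S.A).det • ((S.hermannMartinVector s :
        ExteriorAlgebra ℂ (SplitSpace m p)) * (β : ExteriorAlgebra ℂ (SplitSpace m p))) =
      (S.polePlacementLinear β).eval s • ExteriorAlgebra.ιMulti ℂ (m + p) (splitBasis m p) := by
  have hβ : β ∈ Submodule.span ℂ (Set.range (exteriorPower.ιMulti ℂ p (M := SplitSpace m p))) := by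
    rw [exteriorPower.ιMulti_span]; trivial
  induction hβ using Submodule.span_induction with
  | mem x hx =>
    obtain ⟨v, rfl⟩ := hx
    rw [hermannMartinVector, exteriorPower.ιMulti_apply_coe, exteriorPower.ιMulti_apply_coe,
      ExteriorAlgebra.ιMulti_mul_ιMulti,
      AlternatingMap.map_eq_det_smul (ExteriorAlgebra.ιMulti ℂ (m + p)) (splitBasis m p),
      splitBasis_det_append, polePlacementLinear_ιMulti, eval_det_rosenbrock S hs, smul_smul]
    congr 3
    ext1 i j
    rcases i with i | i <;> rcases j with j | j <;> rfl
  | zero => simp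
  | add x y _ _ hx hy =>
    rw [Submodule.coe_add, mul_add, smul_add, hx, hy, map_add, eval_add, add_smul]
  | smul c x _ hx =>
    rw [Submodule.coe_smul, mul_smul_comm, smul_comm, hx, map_smul, eval_smul, smul_eq_mul,
      mul_smul]

theorem hermannMartinVector_mul_eq_zero_iff (S : LinearSystem N m p) {s : ℂ}
    (hs : S.IsRegularPoint s) (β : ⋀[ℂ]^p (SplitSpace m p)) :
    (S.hermannMartinVector s : ExteriorAlgebra ℂ (SplitSpace m p)) *
        (β : ExteriorAlgebra ℂ (SplitSpace m p)) = 0 ↔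
      (S.polePlacementLinear β).eval s = 0 := by
  have h := S.smul_hermannMartinVector_mul hs β
  constructor
  · intro h0
    rw [h0, smul_zero] at h
    exact (smul_eq_zero.1 h.symm).resolve_right (ExteriorAlgebra.ιMulti_basis_ne_zero _)
  · intro h0
    rw [h0, zero_smul] at h
    exact (smul_eq_zero.1 h).resolve_left hs.ne_zero

theorem mem_center_iff (S : LinearSystem N m p) (β : ⋀[ℂ]^p (SplitSpace m p)) :
    β ∈ S.center ↔ ∀ s, S.IsRegularPoint s →
      (S.hermannMartinVector s : ExteriorAlgebra ℂ (SplitSpace m p)) *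
        (β : ExteriorAlgebra ℂ (SplitSpace m p)) = 0 := by
  constructor
  · exact fun h s hs => h _ (Submodule.subset_span ⟨s, hs, rfl⟩)
  · intro h α hα
    induction hα using Submodule.span_induction with
    | mem x hx =>
      obtain ⟨s, hs, rfl⟩ := hx
      exact h s hs
    | zero => simp
    | add x y _ _ hx hy => rw [Submodule.coe_add, add_mul, hx, hy, add_zero]
    | smul c x _ hx => rw [Submodule.coe_smul, smul_mul_assoc, hx, smul_zero]

/-- Vanishing of the wedge with `γ(s)` and of the polynomial at `s` are equivalent at every regular
`s`, and a polynomial with infinitely many roots is zero. -/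
theorem ker_polePlacementLinear (S : LinearSystem N m p) :
    LinearMap.ker S.polePlacementLinear = S.center := by
  ext β
  rw [LinearMap.mem_ker, mem_center_iff]
  constructor
  · intro h s hs
    rw [S.hermannMartinVector_mul_eq_zero_iff hs, h, eval_zero]
  · intro h
    refine Polynomial.eq_zero_of_infinite_isRoot _
      (S.finite_setOf_not_isRegularPoint.infinite_compl.mono fun s hs => ?_)
    have hs : S.IsRegularPoint s := not_not.1 hs
    exact (S.hermannMartinVector_mul_eq_zero_iff hs β).1 (h s hs)

/-- A vector which is annihilated by all but finitely many points of the Hermann-Martin curve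
lies in the center. -/
theorem mem_center_of_finite (S : LinearSystem N m p) (β : ⋀[ℂ]^p (SplitSpace m p)) {F : Set ℂ}
    (hF : F.Finite) (h : ∀ s, s ∉ F → S.IsRegularPoint s →
      (S.hermannMartinVector s : ExteriorAlgebra ℂ (SplitSpace m p)) *
        (β : ExteriorAlgebra ℂ (SplitSpace m p)) = 0) : β ∈ S.center := by
  rw [← ker_polePlacementLinear, LinearMap.mem_ker]
  refine Polynomial.eq_zero_of_infinite_isRoot _
    ((S.finite_setOf_not_isRegularPoint.union hF).infinite_compl.mono fun s hs => ?_)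
  rw [Set.mem_compl_iff, Set.mem_union, not_or] at hs
  have hs' : S.IsRegularPoint s := not_not.1 hs.1
  exact (S.hermannMartinVector_mul_eq_zero_iff hs' β).1 (h s hs.2 hs')

/-- The injective linear map `(∧ᵖ V) / Z → ℂ[s]` induced by `polePlacementLinear`. -/
def polePlacementQuotient (S : LinearSystem N m p) :
    ((⋀[ℂ]^p (SplitSpace m p)) ⧸ S.center) →ₗ[ℂ] ℂ[X] :=
  S.center.liftQ S.polePlacementLinear S.ker_polePlacementLinear.ge

theorem polePlacementQuotient_mkQ (S : LinearSystem N m p) (β : ⋀[ℂ]^p (SplitSpace m p)) :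
    S.polePlacementQuotient (S.center.mkQ β) = S.polePlacementLinear β :=
  Submodule.liftQ_apply _ _ _

theorem polePlacementQuotient_injective (S : LinearSystem N m p) :
    Function.Injective S.polePlacementQuotient :=
  LinearMap.ker_eq_bot.1 (Submodule.ker_liftQ_eq_bot _ _ _ S.ker_polePlacementLinear.le)

theorem polePlacementIsWronskiMap_center (S : LinearSystem N m p) :
    S.PolePlacementIsWronskiMap S.center := by
  refine ⟨S.polePlacementQuotient, S.polePlacementQuotient_injective, ?_, fun K => ?_⟩
  · rw [polePlacementQuotient, Submodule.range_liftQ]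
    exact S.range_polePlacementLinear_le
  · rw [wronskiMap, pluckerLine_chart, Submodule.map_span, Set.image_singleton, Submodule.map_span,
      Set.image_singleton, polePlacementQuotient_mkQ, polePlacementLinear_chartVector]

end LinearSystem

/-! ### The dual form in a symplectic basis -/

section DualForm

variable {ι : Type} [Fintype ι] [DecidableEq ι]

/-- The dual form of `ω` is half of the sum of `ψ(bₖ*) ∧ bₖ` for any basis `b`, where `ψ` is the
inverse of `u ↦ ω(u, ·)`. -/
theorem dualForm_eq_sum_coord {κ : Type*} [Fintype κ] (ω : LinearMap.BilinForm ℂ (ι → ℂ))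
    (hω : ω.Nondegenerate) (b : Module.Basis κ ℂ (ι → ℂ)) :
    dualForm ω hω = (1 / 2 : ℂ) • ∑ k, ExteriorAlgebra.ι ℂ ((ω.toDual hω).symm (b.coord k)) *
      ExteriorAlgebra.ι ℂ (b k) := by
  have h1 : ∀ i : ι, ∑ j, ω (Pi.single i 1) (Pi.single j 1) •
      (LinearMap.proj j : Module.Dual ℂ (ι → ℂ)) = ω.toDual hω (Pi.single i 1) := by
    intro i
    refine (Pi.basisFun ℂ ι).ext fun k => ?_
    simp [LinearMap.BilinForm.toDual_def, Pi.single_apply]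
  have h2 : ∀ k : κ, ∑ i, b.coord k (Pi.single i 1) •
      (LinearMap.proj i : Module.Dual ℂ (ι → ℂ)) = b.coord k := by
    intro k
    refine (Pi.basisFun ℂ ι).ext fun k => ?_
    simp [Pi.single_apply]
  -- Summing over `j` turns the second factor into `ω(eᵢ, ·)`, which `ψ` sends back to `eᵢ`. What
  -- remains comes from the canonical element of `V* ⊗ V`, hence does not depend on the basis.
  have h3 : dualForm ω hω = (1 / 2 : ℂ) • ∑ i : ι,
      ExteriorAlgebra.ι ℂ ((ω.toDual hω).symm (LinearMap.proj i)) *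
        ExteriorAlgebra.ι ℂ (Pi.single i 1 : ι → ℂ) := by
    rw [dualForm, alternatingTensor, map_smul, map_sum]
    congr 1
    refine Finset.sum_congr rfl fun i _ => ?_
    conv_rhs => rw [← (ω.toDual hω).symm_apply_apply (Pi.single i 1), ← h1 i]
    simp only [map_sum, map_smul, map_mul, ExteriorAlgebra.map_apply_ι, Finset.mul_sum,
      mul_smul_comm, LinearEquiv.coe_coe]
  rw [h3]
  congr 1
  have h4 : ∀ i : ι, (Pi.single i 1 : ι → ℂ) = ∑ k, b.coord k (Pi.single i 1) • b k :=
    fun i => (b.sum_repr _).symm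
  calc _ = ∑ i, ∑ k, b.coord k (Pi.single i 1) •
        (ExteriorAlgebra.ι ℂ ((ω.toDual hω).symm (LinearMap.proj i)) *
          ExteriorAlgebra.ι ℂ (b k)) := by
        refine Finset.sum_congr rfl fun i _ => ?_
        conv_lhs => rw [h4 i]
        simp only [map_sum, map_smul, Finset.mul_sum, mul_smul_comm]
    _ = _ := by
        rw [Finset.sum_comm]
        refine Finset.sum_congr rfl fun k _ => ?_
        conv_rhs => rw [← h2 k]
        simp only [map_sum, map_smul, Finset.sum_mul, smul_mul_assoc]

/-- In a symplectic basis `hⱼ, gⱼ`, the dual form is `∑ hⱼ ∧ gⱼ`. -/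
theorem dualForm_eq_sum_of_symplectic {κ : Type*} [Fintype κ] [DecidableEq κ]
    (ω : LinearMap.BilinForm ℂ (ι → ℂ)) (hω : ω.Nondegenerate)
    (b : Module.Basis (κ ⊕ κ) ℂ (ι → ℂ))
    (hb : ∀ i j, ω (b i) (b j) = Matrix.fromBlocks (0 : Matrix κ κ ℂ) 1 (-1) 0 i j) :
    dualForm ω hω = ∑ k, ExteriorAlgebra.ι ℂ (b (Sum.inl k)) *
      ExteriorAlgebra.ι ℂ (b (Sum.inr k)) := by
  have hl : ∀ k, (ω.toDual hω).symm (b.coord (Sum.inl k)) = -b (Sum.inr k) := by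
    intro k
    rw [LinearEquiv.symm_apply_eq]
    refine b.ext fun i => ?_
    rcases i with i | i <;>
      simp [LinearMap.BilinForm.toDual_def, hb, Finsupp.single_apply, Matrix.one_apply, eq_comm]
  have hr : ∀ k, (ω.toDual hω).symm (b.coord (Sum.inr k)) = b (Sum.inl k) := by
    intro k
    rw [LinearEquiv.symm_apply_eq]
    refine b.ext fun i => ?_
    rcases i with i | i <;>
      simp [LinearMap.BilinForm.toDual_def, hb, Finsupp.single_apply, Matrix.one_apply, eq_comm]
  rw [dualForm_eq_sum_coord ω hω b, Fintype.sum_sum_type, ← Finset.sum_add_distrib, Finset.smul_sum]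
  refine Finset.sum_congr rfl fun k _ => ?_
  -- The terms `-gₖ ∧ hₖ` and `hₖ ∧ gₖ` are equal, which absorbs the factor 1/2.
  rw [hl, hr, map_neg, neg_mul, ← eq_neg_of_add_eq_zero_left (ExteriorAlgebra.ι_add_mul_swap _ _),
    ← two_smul ℂ, smul_smul]
  norm_num

end DualForm

/-! ### State feedback, symmetry and the self-adjoint center -/

namespace LinearSystem

open Polynomial

variable {N m p : ℕ}

/-- `S'` is obtained from `S` by the state feedback transformation `(L, W, T, Q)`. -/
structure IsStateFeedback (S S' : LinearSystem N m p) (L : Matrix (Fin N) (Fin N) ℂ)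
    (W : Matrix (Fin m) (Fin m) ℂ) (T : Matrix (Fin p) (Fin p) ℂ)
    (Q : Matrix (Fin m) (Fin p) ℂ) : Prop where
  isUnit_L : IsUnit L.det
  isUnit_W : IsUnit W.det
  isUnit_T : IsUnit T.det
  A_eq : S'.A = L⁻¹ * (S.A + S.B * Q * T⁻¹ * S.C) * L
  B_eq : S'.B = L⁻¹ * S.B * W
  C_eq : S'.C = T⁻¹ * S.C * L

namespace IsStateFeedback

variable {S S' : LinearSystem N m p} {L : Matrix (Fin N) (Fin N) ℂ}
  {W : Matrix (Fin m) (Fin m) ℂ} {T : Matrix (Fin p) (Fin p) ℂ} {Q : Matrix (Fin m) (Fin p) ℂ}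

/-- The two closed-loop matrices are conjugate by `L`. -/
theorem polePlacement_eq (h : S.IsStateFeedback S' L W T Q) (K : Matrix (Fin m) (Fin p) ℂ) :
    S.polePlacement ((Q + W * K) * T⁻¹) = S'.polePlacement K := by
  have h1 : S'.A + S'.B * K * S'.C = L⁻¹ * ((S.A + S.B * ((Q + W * K) * T⁻¹) * S.C) * L) := by
    rw [h.A_eq, h.B_eq, h.C_eq]
    simp only [Matrix.mul_add, Matrix.add_mul, Matrix.mul_assoc, add_assoc]
  rw [polePlacement, polePlacement, h1, Matrix.charpoly_mul_comm,
    Matrix.mul_assoc (S.A + _), Matrix.mul_nonsing_inv _ h.isUnit_L, Matrix.mul_one]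

/-- This says that `[[W, Q], [0, T]]` carries the curve of `S'` into that of `S`: the columns of `(W
+ Q G'; T G')` are combinations of those of `(1; G)`. -/
theorem transfer_mul (h : S.IsStateFeedback S' L W T Q) {s : ℂ} (hs : S.IsRegularPoint s)
    (hs' : S'.IsRegularPoint s) :
    S.transfer s * (W + Q * S'.transfer s) = T * S'.transfer s := by
  set F := Matrix.scalar (Fin N) s - S.A with hF
  set F' := F - S.B * Q * T⁻¹ * S.C with hF'
  have h1 : Matrix.scalar (Fin N) s - S'.A = L⁻¹ * F' * L := by
    rw [h.A_eq, hF', hF, sub_sub, Matrix.mul_sub, Matrix.sub_mul,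
      ← (Matrix.scalar_commute s (fun _ => Commute.all _ _) L⁻¹).eq, Matrix.mul_assoc _ L⁻¹ L,
      Matrix.nonsing_inv_mul _ h.isUnit_L, Matrix.mul_one]
  have hdet : IsUnit F'.det := by
    have h2 : IsUnit (L⁻¹ * F' * L).det := h1 ▸ hs'
    rw [Matrix.det_mul, Matrix.det_mul, IsUnit.mul_iff, IsUnit.mul_iff] at h2
    exact h2.1.2
  have h3 : S'.transfer s = T⁻¹ * S.C * F'⁻¹ * S.B * W := by
    rw [transfer, h1, h.B_eq, h.C_eq, Matrix.mul_inv_rev, Matrix.mul_inv_rev,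
      Matrix.nonsing_inv_nonsing_inv _ h.isUnit_L]
    calc _ = T⁻¹ * S.C * ((L * L⁻¹) * F'⁻¹ * (L * L⁻¹)) * S.B * W := by
          simp only [Matrix.mul_assoc]
      _ = _ := by
          rw [Matrix.mul_nonsing_inv _ h.isUnit_L, Matrix.mul_one, Matrix.one_mul]
  have h4 : T * S'.transfer s = S.C * F'⁻¹ * S.B * W := by
    rw [h3]
    simp only [← Matrix.mul_assoc]
    rw [Matrix.mul_nonsing_inv _ h.isUnit_T, Matrix.one_mul]
  have h5 : F = F' + S.B * Q * T⁻¹ * S.C := by rw [hF', sub_add_cancel]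
  rw [h4, transfer, ← hF, h3]
  -- Resolvent identity: writing `1 = F' F'⁻¹` makes the bracket equal to `F F'⁻¹`.
  calc _ = S.C * (F⁻¹ * (F' * F'⁻¹ + S.B * Q * T⁻¹ * S.C * F'⁻¹)) * S.B * W := by
        rw [Matrix.mul_nonsing_inv _ hdet]
        simp only [Matrix.mul_assoc, Matrix.mul_add, Matrix.add_mul, Matrix.mul_one]
    _ = S.C * (F⁻¹ * F * F'⁻¹) * S.B * W := by
        rw [← Matrix.add_mul, ← h5, Matrix.mul_assoc F⁻¹]
    _ = _ := by rw [Matrix.nonsing_inv_mul _ hs, Matrix.one_mul]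

end IsStateFeedback

/-- At regular `s` the polynomial is `det (s - A) * det (1 - G K)`, and for symmetric `G` one has
`det (1 - G K) = det (1 - Kᵀ G) = det (1 - G Kᵀ)`. -/
theorem IsSymmetric.polePlacement_transpose {S : LinearSystem N m m} (hS : S.IsSymmetric)
    (K : Matrix (Fin m) (Fin m) ℂ) : S.polePlacement K.transpose = S.polePlacement K := by
  refine Polynomial.eq_of_infinite_eval_eq _ _
    (S.finite_setOf_not_isRegularPoint.infinite_compl.mono fun s hs => ?_)
  have hs : S.IsRegularPoint s := not_not.1 hs
  rw [Set.mem_ofPred_eq, ← det_rosenbrock_chartMatrix, ← det_rosenbrock_chartMatrix,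
    eval_det_rosenbrock S hs, eval_det_rosenbrock S hs]
  simp only [chartMatrix, Matrix.toRows₁_fromRows, Matrix.toRows₂_fromRows,
    Matrix.det_fromBlocks_one₁₁]
  rw [← Matrix.det_transpose (1 - _), Matrix.transpose_sub, Matrix.transpose_mul, Matrix.transpose_one,
    Matrix.transpose_transpose, hS s hs, Matrix.det_one_sub_mul_comm]

/-- The symplectic form for which the Hermann-Martin curve is isotropic. -/
def feedbackForm (W T Q : Matrix (Fin m) (Fin m) ℂ) : LinearMap.BilinForm ℂ (SplitSpace m m) :=
  Matrix.toBilin' (((Matrix.fromBlocks W Q 0 T)⁻¹).transpose *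
    Matrix.fromBlocks 0 1 (-1) 0 * (Matrix.fromBlocks W Q 0 T)⁻¹)

section

variable {W T Q : Matrix (Fin m) (Fin m) ℂ}

theorem isUnit_det_feedbackMatrix (hW : IsUnit W.det) (hT : IsUnit T.det) :
    IsUnit (Matrix.fromBlocks W Q 0 T).det := by
  rw [Matrix.det_fromBlocks_zero₂₁]
  exact hW.mul hT

theorem isAlt_feedbackForm : (feedbackForm W T Q).IsAlt := by
  intro x
  rw [feedbackForm, Matrix.toBilin'_apply', ← Matrix.mulVec_mulVec, ← Matrix.mulVec_mulVec,
    Matrix.dotProduct_mulVec, Matrix.vecMul_transpose]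
  generalize (Matrix.fromBlocks W Q 0 T)⁻¹.mulVec x = y
  simp [dotProduct, Matrix.mulVec, Matrix.one_apply, Matrix.fromBlocks_apply₁₁, mul_comm]

theorem nondegenerate_feedbackForm (hW : IsUnit W.det) (hT : IsUnit T.det) :
    (feedbackForm W T Q).Nondegenerate := by
  refine LinearMap.BilinForm.nondegenerate_toBilin'_of_det_ne_zero' _ ?_
  have h1 : IsUnit (Matrix.fromBlocks (0 : Matrix (Fin m) (Fin m) ℂ) 1 (-1)
      (0 : Matrix (Fin m) (Fin m) ℂ)).det := by
    have := Matrix.isUnit_det_J (Fin m) ℂ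
    rw [← Matrix.det_transpose] at this
    simpa [Matrix.J, Matrix.fromBlocks_transpose] using this
  have h2 : IsUnit ((Matrix.fromBlocks W Q 0 T)⁻¹).det :=
    Matrix.isUnit_nonsing_inv_det _ (isUnit_det_feedbackMatrix hW hT)
  rw [Matrix.det_mul, Matrix.det_mul, Matrix.det_transpose]
  exact ((h2.mul h1).mul h2).ne_zero

/-- The columns of `(W + Q G; T G)` and `(Q; T)` form a symplectic basis if `G` is symmetric. -/
theorem exists_symplectic_basis (hW : IsUnit W.det) (hT : IsUnit T.det)
    {G : Matrix (Fin m) (Fin m) ℂ} (hG : G.transpose = G) :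
    ∃ b : Module.Basis (Fin m ⊕ Fin m) ℂ (SplitSpace m m),
      (∀ i j, feedbackForm W T Q (b i) (b j) =
        Matrix.fromBlocks (0 : Matrix (Fin m) (Fin m) ℂ) 1 (-1) (0 : Matrix (Fin m) (Fin m) ℂ) i j) ∧
      ∀ j, b (Sum.inl j) = (Matrix.fromRows (W + Q * G) (T * G)).transpose j := by
  set P := Matrix.fromBlocks W Q 0 T with hP
  have hPdet : IsUnit P.det := isUnit_det_feedbackMatrix hW hT
  set E : Matrix (Fin m ⊕ Fin m) (Fin m ⊕ Fin m) ℂ := P * Matrix.fromBlocks 1 0 G 1 with hE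
  have hEdet : IsUnit E.det := by
    rw [hE, Matrix.det_mul, Matrix.det_fromBlocks_zero₁₂]
    simpa using hPdet
  have hb : ∀ i, (Pi.basisFun ℂ (Fin m ⊕ Fin m)).map
      (Matrix.toLinearEquiv (Pi.basisFun ℂ (Fin m ⊕ Fin m)) E hEdet) i =
        E.mulVec (Pi.single i 1) := by
    intro i
    rw [Module.Basis.map_apply, Pi.basisFun_apply]
    rfl
  refine ⟨_, fun i j => ?_, fun j => (hb _).trans ?_⟩
  · rw [hb, hb]
    change ((feedbackForm W T Q).comp (Matrix.toLin' E) (Matrix.toLin' E))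
      (Pi.single i 1) (Pi.single j 1) = _
    rw [feedbackForm, Matrix.toBilin'_comp, Matrix.toBilin'_single, ← hP]
    have h1 : P⁻¹ * E = Matrix.fromBlocks 1 0 G 1 := by
      rw [hE, ← Matrix.mul_assoc, Matrix.nonsing_inv_mul _ hPdet, Matrix.one_mul]
    have h2 : E.transpose * (P⁻¹.transpose * Matrix.fromBlocks 0 1 (-1) 0 * P⁻¹) * E =
        (P⁻¹ * E).transpose * Matrix.fromBlocks 0 1 (-1) 0 * (P⁻¹ * E) := by
      simp only [Matrix.transpose_mul, Matrix.mul_assoc]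
    rw [h2, h1, Matrix.fromBlocks_transpose, Matrix.fromBlocks_multiply, Matrix.fromBlocks_multiply]
    simp [hG]
  · rw [Matrix.mulVec_single_one, hE, hP, Matrix.fromBlocks_multiply]
    ext1 (i | i) <;> simp

end

theorem isSelfAdjointCenter_center {S S' : LinearSystem N m m} (hS : S.StateFeedbackEquiv S')
    (hS' : S'.IsSymmetric) : IsSelfAdjointCenter S.center := by
  obtain ⟨L, W, T, Q, hL, hW, hT, hA, hB, hC⟩ := hS
  have h : S.IsStateFeedback S' L W T Q := ⟨hL, hW, hT, hA, hB, hC⟩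
  refine ⟨feedbackForm W T Q, nondegenerate_feedbackForm hW hT, isAlt_feedbackForm, ?_⟩
  rw [dualFormWedge, Submodule.span_le]
  rintro x ⟨k, -, β, hx⟩
  -- Feedback moves poles, so the finitely many poles of `S'` are discarded as well.
  refine S.mem_center_of_finite x S'.finite_setOf_not_isRegularPoint fun s hs' hs => ?_
  have hs' : S'.IsRegularPoint s := not_not.1 hs'
  obtain ⟨b, hb, hbl⟩ := exists_symplectic_basis (Q := Q) hW hT (hS' s hs')
  -- The symplectic basis depends on `s`, but `θ` does not. Each summand starts with a vector of
  -- `γ(s)` and so is killed by its Plücker vector.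
  rw [hx, ← mul_assoc, dualForm_eq_sum_of_symplectic _ _ b hb, Finset.mul_sum,
    Finset.sum_eq_zero, zero_mul]
  intro j _
  rw [← mul_assoc, hermannMartinVector, exteriorPower.ιMulti_apply_coe,
    ExteriorAlgebra.ιMulti_mul_ι_of_mem_span, zero_mul]
  have h1 : Matrix.fromRows (W + Q * S'.transfer s) (T * S'.transfer s) =
      Matrix.fromRows 1 (S.transfer s) * (W + Q * S'.transfer s) := by
    rw [Matrix.fromRows_mul, Matrix.one_mul, h.transfer_mul hs hs']
  rw [hbl, h1]
  have h2 := (Matrix.fromRows (1 : Matrix (Fin m) (Fin m) ℂ) (S.transfer s)).range_mulVecLin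
  change _ ∈ Submodule.span ℂ (Set.range (Matrix.fromRows (1 : Matrix (Fin m) (Fin m) ℂ) (S.transfer s)).col)
  rw [← h2]
  exact ⟨fun i => (W + Q * S'.transfer s) i j, rfl⟩

end LinearSystem

/-! ### Properness and finiteness of the degree -/

namespace Matrix

variable {R : Type*} [CommRing R] {r n : Type*} [Fintype n] [DecidableEq n]

/-- Cramer's rule: after normalizing the rows `I` to the identity, the entries of a matrix are
ratios of its maximal minors. -/
theorem mul_adjugate_submatrix_apply (M : Matrix r n R) (I : n → r) (i : r) (j : n) :
    (M * (M.submatrix I id).adjugate) i j = (M.submatrix (Function.update I j i) id).det := by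
  have h1 : M.submatrix (Function.update I j i) id = (M.submatrix I id).updateRow j (M i) := by
    ext a b
    by_cases h : a = j
    · subst h; simp
    · simp [h]
  rw [h1, ← Matrix.cramer_transpose_apply, Matrix.cramer_eq_adjugate_mulVec,
    ← Matrix.adjugate_transpose, Matrix.mulVec_transpose]
  rfl

theorem det_fromRows_one_submatrix_update (K : Matrix r n R) (i : r) (j : n) :
    ((Matrix.fromRows K 1).submatrix (Function.update Sum.inr j (Sum.inl i)) id).det = K i j := by
  rw [← mul_adjugate_submatrix_apply]
  have h1 : (Matrix.fromRows K 1).submatrix (Sum.inr : n → r ⊕ n) id = 1 := rfl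
  rw [h1, Matrix.adjugate_one, Matrix.mul_one, Matrix.fromRows_apply_inl]

end Matrix

namespace LinearSystem

open Polynomial

variable {N m p : ℕ}

theorem det_rosenbrock_eq_zero_of_coeff (S : LinearSystem N m p) {R : Type*} [CommRing R]
    [Algebra ℂ R] (M : Matrix (Fin m ⊕ Fin p) (Fin p) R)
    (h : ∀ k : Fin (N + 1), (S.rosenbrock M).det.coeff k = 0) : (S.rosenbrock M).det = 0 := by
  ext k
  rw [coeff_zero]
  by_cases hk : k < N + 1
  · exact h ⟨k, hk⟩
  · exact coeff_eq_zero_of_natDegree_lt ((S.natDegree_det_rosenbrock_le M).trans_lt (by omega))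

/-- Otherwise the Plücker line of the column space of `M` would lie in the kernel, which is `Z`. -/
theorem IsProper.det_rosenbrock_ne_zero {S : LinearSystem N m p} (hS : S.IsProper)
    (M : Matrix (Fin m ⊕ Fin p) (Fin p) ℂ) (hM : Function.Injective M.mulVec) :
    (S.rosenbrock M).det ≠ 0 := by
  intro h
  have hli : LinearIndependent ℂ M.col := Matrix.mulVec_injective_iff.1 hM
  have hrank : Module.finrank ℂ (Submodule.span ℂ (Set.range M.col)) = p := by
    rw [finrank_span_eq_card hli, Fintype.card_fin]
  have hH := pluckerLine_eq_span (⟨_, hrank⟩ : {H : Submodule ℂ (SplitSpace m p) // Module.finrank ℂ H = p}) _ hli rfl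
  refine hS ⟨_, hrank⟩ (hH.trans_le ?_)
  · rw [Submodule.span_singleton_le_iff_mem,
      ← ker_polePlacementLinear, LinearMap.mem_ker]
    exact (S.polePlacementLinear_columns M).trans h

theorem aeval_coeff_det_rosenbrock_mvPolynomialX (S : LinearSystem N m p) {R : Type*} [CommRing R]
    [Algebra ℂ R] (M : Matrix (Fin m ⊕ Fin p) (Fin p) R) (k : ℕ) :
    MvPolynomial.aeval (fun ij => M ij.1 ij.2)
        ((S.rosenbrock (Matrix.mvPolynomialX (Fin m ⊕ Fin p) (Fin p) ℂ)).det.coeff k) =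
      (S.rosenbrock M).det.coeff k := by
  have h : (Matrix.mvPolynomialX (Fin m ⊕ Fin p) (Fin p) ℂ).map
      (MvPolynomial.aeval (R := ℂ) fun ij => M ij.1 ij.2) = M := by
    ext i j
    simp
  conv_rhs => rw [← h, ← S.map_det_rosenbrock, coeff_map]
  rfl

theorem aeval_mvPolynomialX_sub_one {R : Type*} [CommRing R] [Algebra ℂ R]
    (M : Matrix (Fin m ⊕ Fin p) (Fin p) R) (a : Fin m ⊕ Fin p) (i j : Fin p) :
    MvPolynomial.aeval (fun ij => M ij.1 ij.2)
        (Matrix.mvPolynomialX (Fin m ⊕ Fin p) (Fin p) ℂ a j -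
          (1 : Matrix (Fin p) (Fin p) _) i j) = M a j - (1 : Matrix (Fin p) (Fin p) R) i j := by
  simp only [map_sub, Matrix.mvPolynomialX_apply, MvPolynomial.aeval_X, Matrix.one_apply]
  split_ifs <;> simp

/-- By the Nullstellensatz, properness says that the coefficients of the pole placement map generate
the unit ideal on each of the standard affine charts of the Grassmannian. -/
theorem IsProper.exists_sum_mul_coeff_eq_one {S : LinearSystem N m p} (hS : S.IsProper)
    (I : Fin p → Fin m ⊕ Fin p) {E : Type*} [CommRing E] [Algebra ℂ E]
    (M : Matrix (Fin m ⊕ Fin p) (Fin p) E) (hM : M.submatrix I id = 1) :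
    ∃ g : Fin (N + 1) → MvPolynomial ((Fin m ⊕ Fin p) × Fin p) ℂ,
      ∑ k, MvPolynomial.aeval (fun ij => M ij.1 ij.2) (g k) * (S.rosenbrock M).det.coeff k = 1 := by
  let Y := Matrix.mvPolynomialX (Fin m ⊕ Fin p) (Fin p) ℂ
  let f : Fin (N + 1) → MvPolynomial ((Fin m ⊕ Fin p) × Fin p) ℂ :=
    fun k => (S.rosenbrock Y).det.coeff k
  let r : Fin p × Fin p → MvPolynomial ((Fin m ⊕ Fin p) × Fin p) ℂ :=
    fun ij => Y (I ij.1) ij.2 - (1 : Matrix (Fin p) (Fin p) _) ij.1 ij.2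
  have htop : Ideal.span (Set.range f) ⊔ Ideal.span (Set.range r) = ⊤ := by
    -- A common zero is a complex matrix `M₀` whose rows `I` form the identity, hence an injective
    -- one, with zero Rosenbrock determinant. Properness excludes it.
    rw [← Ideal.radical_eq_top, ← MvPolynomial.vanishingIdeal_zeroLocus_eq_radical (K := ℂ)]
    convert MvPolynomial.vanishingIdeal_empty
    rw [Set.eq_empty_iff_forall_notMem]
    intro x hx
    let M₀ : Matrix (Fin m ⊕ Fin p) (Fin p) ℂ := Matrix.of fun i j => x (i, j)
    have hM₀ : M₀.submatrix I id = 1 := by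
      ext i j
      have := hx (r (i, j)) (Ideal.mem_sup_right (Ideal.subset_span ⟨_, rfl⟩))
      exact sub_eq_zero.1 ((aeval_mvPolynomialX_sub_one M₀ _ i j).symm.trans this)
    refine hS.det_rosenbrock_ne_zero M₀ ?_ (S.det_rosenbrock_eq_zero_of_coeff _ fun k => ?_)
    · intro y z hyz
      have h1 : ∀ w, (M₀.mulVec w) ∘ I = w := fun w => by
        conv_rhs => rw [← Matrix.one_mulVec w, ← hM₀]
        rfl
      rw [← h1 y, ← h1 z, hyz]
    · exact (S.aeval_coeff_det_rosenbrock_mvPolynomialX M₀ k).symm.trans (hx (f k) (Ideal.mem_sup_left (Ideal.subset_span ⟨_, rfl⟩)))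
  obtain ⟨y, hy, z, hz, hyz⟩ := Submodule.mem_sup.1 ((Ideal.eq_top_iff_one _).1 htop)
  obtain ⟨g, rfl⟩ := Ideal.mem_span_range_iff_exists_fun.1 hy
  refine ⟨g, ?_⟩
  have hz0 : MvPolynomial.aeval (fun ij => M ij.1 ij.2) z = 0 := by
    have : Ideal.span (Set.range r) ≤
        RingHom.ker (MvPolynomial.aeval (R := ℂ) fun ij => M ij.1 ij.2) := by
      rw [Ideal.span_le]
      rintro _ ⟨⟨i, j⟩, rfl⟩
      refine (aeval_mvPolynomialX_sub_one M _ i j).trans ?_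
      rw [← hM, Matrix.submatrix_apply, id, sub_self]
    exact this hz
  have := congrArg (MvPolynomial.aeval (fun ij => M ij.1 ij.2)) hyz
  rw [map_add, hz0, add_zero, map_one, map_sum] at this
  rw [← this]
  exact Finset.sum_congr rfl fun k _ => by
    rw [map_mul, S.aeval_coeff_det_rosenbrock_mvPolynomialX]

/-- The valuative criterion for the pole placement map of a proper system. -/
theorem IsProper.mem_valuationSubring {S : LinearSystem N m p} (hS : S.IsProper)
    {E : Type*} [Field E] [Algebra ℂ E] (O : ValuationSubring E)
    (hO : ∀ c : ℂ, algebraMap ℂ E c ∈ O) (K : Matrix (Fin m) (Fin p) E)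
    (hK : ∀ k : Fin (N + 1), (S.rosenbrock (Matrix.fromRows K 1)).det.coeff k ∈ O)
    (i : Fin m) (j : Fin p) : K i j ∈ O := by
  set M : Matrix (Fin m ⊕ Fin p) (Fin p) E := Matrix.fromRows K 1 with hMdef
  let d : (Fin p → Fin m ⊕ Fin p) → E := fun I => (M.submatrix I id).det
  -- Dividing by a minor of largest valuation puts the point in a chart where all its coordinates
  -- lie in `O`.
  obtain ⟨I, hI⟩ := Finite.exists_max fun I => O.valuation (d I)
  have hd1 : d Sum.inr = 1 := by
    have : M.submatrix (Sum.inr : Fin p → Fin m ⊕ Fin p) id = 1 := rfl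
    simp only [d, this, Matrix.det_one]
  have hd0 : d I ≠ 0 := by
    intro h0
    have := hI Sum.inr
    rw [hd1, h0, map_one, map_zero] at this
    exact absurd this (not_le.2 zero_lt_one)
  let B := M.submatrix I id
  have hB : IsUnit B.det := isUnit_iff_ne_zero.2 hd0
  let M' := M * B⁻¹
  have hM' : ∀ a b, M' a b = (d I)⁻¹ * d (Function.update I b a) := by
    intro a b
    simp only [M', Matrix.inv_def, Matrix.mul_smul, Matrix.smul_apply, B,
      Matrix.mul_adjugate_submatrix_apply, Ring.inverse_eq_inv', smul_eq_mul, d]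
  have hM'O : ∀ a b, M' a b ∈ O := by
    intro a b
    rw [← O.valuation_le_one_iff, hM', map_mul, map_inv₀, inv_mul_le_one₀]
    · exact hI _
    · exact zero_lt_iff.2 ((Valuation.ne_zero_iff _).2 hd0)
  have hM'I : M'.submatrix I id = 1 := by
    have : M'.submatrix I id = B * B⁻¹ := rfl
    rw [this, Matrix.mul_nonsing_inv _ hB]
  have hMM' : M = M' * B := by
    simp only [M']
    rw [Matrix.mul_assoc, Matrix.nonsing_inv_mul _ hB, Matrix.mul_one]
  obtain ⟨g, hg⟩ := hS.exists_sum_mul_coeff_eq_one I M' hM'I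
  have hgO : ∀ k, MvPolynomial.aeval (fun ij => M' ij.1 ij.2) (g k) ∈ O := by
    intro k
    induction g k using MvPolynomial.induction_on with
    | C c => rw [MvPolynomial.aeval_C]; exact hO c
    | add a b ha hb => rw [map_add]; exact add_mem ha hb
    | mul_X a n ha => rw [map_mul, MvPolynomial.aeval_X]; exact mul_mem ha (hM'O _ _)
  have hdI : d I ∈ O := by
    -- Multiply the unit-ideal relation for `M'` by `d I = det B`: since `M = M' B`, this turns the
    -- coefficients for `M'` into those for `M`, which lie in `O`.
    have h1 : d I = ∑ k : Fin (N + 1), MvPolynomial.aeval (fun ij => M' ij.1 ij.2) (g k) *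
        (S.rosenbrock M).det.coeff k := by
      conv_lhs => rw [← one_mul (d I), ← hg, Finset.sum_mul]
      refine Finset.sum_congr rfl fun k _ => ?_
      conv_rhs => rw [hMM', det_rosenbrock_mul, coeff_mul_C]
      rw [mul_assoc]
    rw [h1]
    exact sum_mem fun k _ => mul_mem (hgO k) (hK k)
  -- The entries of `K` are themselves maximal minors of `(K; 1)`, so `d I` bounds their valuations.
  have h2 : d (Function.update Sum.inr j (Sum.inl i)) = K i j :=
    Matrix.det_fromRows_one_submatrix_update K i j
  rw [← h2, ← O.valuation_le_one_iff]
  exact (hI _).trans ((O.valuation_le_one_iff _).2 hdI)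

/-- The `(m + p) × p` matrix of regular functions on the affine chart of the Grassmannian. -/
def genericChart (m p : ℕ) : Matrix (Fin m ⊕ Fin p) (Fin p) (MvPolynomial (Fin m × Fin p) ℂ) :=
  Matrix.fromRows (Matrix.mvPolynomialX (Fin m) (Fin p) ℂ) 1

theorem isPullback_coeff (S : LinearSystem N m p) (k : ℕ) :
    IsPullback S.center (Polynomial.lcoeff ℂ k ∘ₗ S.polePlacementQuotient)
      ((S.rosenbrock (genericChart m p)).det.coeff k) := by
  intro K
  rw [LinearMap.comp_apply, polePlacementQuotient_mkQ, polePlacementLinear_chartVector,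
    ← det_rosenbrock_chartMatrix, Polynomial.lcoeff_apply]
  have h : (genericChart m p).map (MvPolynomial.aeval (R := ℂ) fun ij => K ij.1 ij.2) =
      chartMatrix K := by
    ext (i | i) j
    · simp [genericChart, chartMatrix]
    · simp only [genericChart, chartMatrix, Matrix.map_apply, Matrix.fromRows_apply_inr,
        Matrix.one_apply]
      split_ifs <;> simp
  rw [← h, ← S.map_det_rosenbrock, coeff_map]
  rfl

theorem coeff_det_rosenbrock_genericChart (S : LinearSystem N m p) :
    (S.rosenbrock (genericChart m p)).det.coeff N = 1 := by
  rw [genericChart, det_rosenbrock_fromRows_one]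
  have h := Matrix.charpoly_monic (S.A.map (algebraMap ℂ (MvPolynomial (Fin m × Fin p) ℂ)) +
    S.B.map (algebraMap ℂ (MvPolynomial (Fin m × Fin p) ℂ)) *
      Matrix.mvPolynomialX (Fin m) (Fin p) ℂ *
      S.C.map (algebraMap ℂ (MvPolynomial (Fin m × Fin p) ℂ)))
  rw [Monic, leadingCoeff, Matrix.charpoly_natDegree_eq_dim, Fintype.card_fin] at h
  exact h

/-- The polynomial is monic of degree `N`, so the coefficient of degree `N` serves as denominator 1.
-/
theorem coeff_mem_imageFunctionField (S : LinearSystem N m p) (k : ℕ) :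
    algebraMap _ (GrFunctionField m p) ((S.rosenbrock (genericChart m p)).det.coeff k) ∈
      imageFunctionField S.center := by
  refine IntermediateField.subset_adjoin _ _ ⟨_, _, _, _, S.isPullback_coeff k,
    S.isPullback_coeff N, ?_, ?_⟩
  · rw [coeff_det_rosenbrock_genericChart]
    exact one_ne_zero
  · rw [coeff_det_rosenbrock_genericChart, map_one, div_one]

end LinearSystem

/-- The integral closure of a subring of a field is the intersection of the valuation rings
containing it. -/
theorem IntermediateField.isIntegral_of_forall_valuationSubring {k E : Type*} [Field k] [Field E]
    [Algebra k E] (F : IntermediateField k E) (x : E)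
    (h : ∀ O : ValuationSubring E, (∀ y ∈ F, y ∈ O) → x ∈ O) : IsIntegral F x := by
  have h1 : x ∈ (integralClosure (Subring.closure (F : Set E)) E).toSubring := by
    rw [← iInf_valuationSubring_superset, Subring.mem_iInf]
    exact fun V => h V.1 fun y hy => V.2 hy
  have h2 : IsIntegral (Subring.closure (F : Set E)) x := h1
  have hle : Subring.closure (F : Set E) ≤ F.toSubfield.toSubring :=
    Subring.closure_le.2 fun _ h => h
  exact IsIntegral.map_of_comp_eq (T := F) (Subring.inclusion hle : _ →+* F) (RingHom.id E) rfl h2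

/-- The finitely many coordinates generate the function field over `F`. -/
theorem GrFunctionField.finiteDimensional {m p : ℕ}
    (F : IntermediateField ℂ (GrFunctionField m p))
    (h : ∀ ij, IsIntegral F (algebraMap (MvPolynomial (Fin m × Fin p) ℂ) (GrFunctionField m p)
      (MvPolynomial.X ij))) : FiniteDimensional F (GrFunctionField m p) := by
  set X : Set (GrFunctionField m p) := Set.range fun ij =>
    algebraMap (MvPolynomial (Fin m × Fin p) ℂ) (GrFunctionField m p) (MvPolynomial.X ij) with hX
  have htop : IntermediateField.adjoin F X = ⊤ := by
    have hp : ∀ a : MvPolynomial (Fin m × Fin p) ℂ,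
        algebraMap _ (GrFunctionField m p) a ∈ IntermediateField.adjoin F X := by
      intro a
      induction a using MvPolynomial.induction_on with
      | C c =>
        have : algebraMap (MvPolynomial (Fin m × Fin p) ℂ) (GrFunctionField m p)
            (MvPolynomial.C c) = algebraMap F _ (algebraMap ℂ F c) := by
          rw [← IsScalarTower.algebraMap_apply, ← MvPolynomial.algebraMap_eq,
            ← IsScalarTower.algebraMap_apply]
        rw [this]
        exact IntermediateField.algebraMap_mem _ _
      | add a b ha hb => rw [map_add]; exact add_mem ha hb
      | mul_X a n ha =>
        rw [map_mul]
        exact mul_mem ha (IntermediateField.subset_adjoin _ _ ⟨n, rfl⟩)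
    rw [eq_top_iff]
    intro x _
    obtain ⟨a, b, -, rfl⟩ := IsFractionRing.div_surjective (A := MvPolynomial (Fin m × Fin p) ℂ) x
    exact div_mem (hp a) (hp b)
  have : Finite X := Set.finite_range _
  have hfin : FiniteDimensional F (IntermediateField.adjoin F X) :=
    IntermediateField.finiteDimensional_adjoin (by rintro _ ⟨ij, rfl⟩; exact h ij)
  rw [htop] at hfin
  exact IntermediateField.topEquiv.toLinearEquiv.finiteDimensional

theorem LinearSystem.IsProper.finiteDimensional {N m p : ℕ} {S : LinearSystem N m p}
    (hS : S.IsProper) :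
    FiniteDimensional (imageFunctionField S.center) (GrFunctionField m p) := by
  refine GrFunctionField.finiteDimensional _ fun ij =>
    IntermediateField.isIntegral_of_forall_valuationSubring _ _ fun O hO => ?_
  let f := IsScalarTower.toAlgHom ℂ (MvPolynomial (Fin m × Fin p) ℂ) (GrFunctionField m p)
  have h1 : (genericChart m p).map f =
      Matrix.fromRows ((Matrix.mvPolynomialX (Fin m) (Fin p) ℂ).map f) 1 := by
    ext (i | i) j
    · simp [genericChart]
    · simp only [genericChart, Matrix.map_apply, Matrix.fromRows_apply_inr, Matrix.one_apply]
      split_ifs <;> simp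
  have h2 := hS.mem_valuationSubring O
    (fun c => hO _ ((imageFunctionField S.center).algebraMap_mem c))
    ((Matrix.mvPolynomialX (Fin m) (Fin p) ℂ).map f) (fun k => by
      rw [← h1, ← S.map_det_rosenbrock, Polynomial.coeff_map]
      exact hO _ (S.coeff_mem_imageFunctionField k)) ij.1 ij.2
  simpa [f] using h2

/-! ### The feedback involution and even degree -/

/-- By Artin's theorem `E` has degree 2 over the fixed field of `ψ`, and degrees multiply in towers.
-/
theorem AlgEquiv.even_finrank_of_orderOf_eq_two {F E : Type*} [Field F] [Field E] [Algebra F E]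
    [FiniteDimensional F E] (ψ : E ≃ₐ[F] E) (hψ : orderOf ψ = 2) : Even (Module.finrank F E) := by
  rw [← Module.finrank_mul_finrank F (IntermediateField.fixedField (Subgroup.zpowers ψ)) E,
    IntermediateField.finrank_fixedField_eq_card, Nat.card_zpowers, hψ]
  exact even_two.mul_left _

/-- An involution of `E` over `F` makes the degree of `E` over `F` even. -/
theorem IntermediateField.even_finrank_of_involution {k E : Type*} [Field k] [Field E]
    [Algebra k E] (F : IntermediateField k E) [FiniteDimensional F E] (φ : E ≃ₐ[k] E)
    (hφ : ∀ x ∈ F, φ x = x) (hφ2 : ∀ x, φ (φ x) = x) (hφ1 : ∃ x, φ x ≠ x) :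
    Even (Module.finrank F E) := by
  let ψ : E ≃ₐ[F] E := AlgEquiv.ofRingEquiv (f := (φ : E ≃+* E)) fun x => hφ _ x.2
  have hψ : orderOf ψ = 2 := by
    refine orderOf_eq_prime (AlgEquiv.ext fun x => ?_) fun h => ?_
    · rw [pow_two]
      exact hφ2 x
    · obtain ⟨x, hx⟩ := hφ1
      exact hx (DFunLike.congr_fun h x)
  exact ψ.even_finrank_of_orderOf_eq_two hψ

namespace LinearSystem

open Polynomial

variable {N m : ℕ}

section FeedbackInvolution

variable (W T Q : Matrix (Fin m) (Fin m) ℂ)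

/-- The transposition of feedback matrices, transported along the state feedback transformation
`K ↦ (Q + W K) T⁻¹`. -/
def feedbackInvolution {R : Type*} [CommRing R] [Algebra ℂ R] (K : Matrix (Fin m) (Fin m) R) :
    Matrix (Fin m) (Fin m) R :=
  (Q.map (algebraMap ℂ R) + W.map (algebraMap ℂ R) *
    (W⁻¹.map (algebraMap ℂ R) * (K * T.map (algebraMap ℂ R) - Q.map (algebraMap ℂ R))).transpose) *
      T⁻¹.map (algebraMap ℂ R)

theorem map_feedbackInvolution {R R' : Type*} [CommRing R] [Algebra ℂ R] [CommRing R']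
    [Algebra ℂ R'] (f : R →ₐ[ℂ] R') (K : Matrix (Fin m) (Fin m) R) :
    (feedbackInvolution W T Q K).map f = feedbackInvolution W T Q (K.map f) := by
  have h : ∀ A : Matrix (Fin m) (Fin m) ℂ,
      (A.map (algebraMap ℂ R)).map f = A.map (algebraMap ℂ R') := by
    intro A
    ext i j
    simp
  simp only [feedbackInvolution, Matrix.map_mul, Matrix.map_add f (map_add f),
    Matrix.map_sub f (map_sub f), Matrix.transpose_map, h]

variable {W T Q}

theorem map_mul_map_inv {R : Type*} [CommRing R] [Algebra ℂ R] (hW : IsUnit W.det) :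
    W.map (algebraMap ℂ R) * W⁻¹.map (algebraMap ℂ R) = 1 := by
  rw [← Matrix.map_mul, Matrix.mul_nonsing_inv _ hW, Matrix.map_one _ (map_zero _) (map_one _)]

theorem map_inv_mul_map {R : Type*} [CommRing R] [Algebra ℂ R] (hW : IsUnit W.det) :
    W⁻¹.map (algebraMap ℂ R) * W.map (algebraMap ℂ R) = 1 := by
  rw [← Matrix.map_mul, Matrix.nonsing_inv_mul _ hW, Matrix.map_one _ (map_zero _) (map_one _)]

theorem feedbackInvolution_apply {R : Type*} [CommRing R] [Algebra ℂ R] (hW : IsUnit W.det)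
    (hT : IsUnit T.det) (K : Matrix (Fin m) (Fin m) R) :
    feedbackInvolution W T Q ((Q.map (algebraMap ℂ R) + W.map (algebraMap ℂ R) * K) *
        T⁻¹.map (algebraMap ℂ R)) =
      (Q.map (algebraMap ℂ R) + W.map (algebraMap ℂ R) * K.transpose) *
        T⁻¹.map (algebraMap ℂ R) := by
  rw [feedbackInvolution, Matrix.mul_assoc (_ + _), map_inv_mul_map hT, Matrix.mul_one,
    add_sub_cancel_left, ← Matrix.mul_assoc (W⁻¹.map _), map_inv_mul_map hW, Matrix.one_mul]

theorem feedbackInvolution_involutive {R : Type*} [CommRing R] [Algebra ℂ R] (hW : IsUnit W.det)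
    (hT : IsUnit T.det) (K : Matrix (Fin m) (Fin m) R) :
    feedbackInvolution W T Q (feedbackInvolution W T Q K) = K := by
  conv_lhs => rw [feedbackInvolution.eq_def W T Q K, feedbackInvolution_apply hW hT,
    Matrix.transpose_transpose, ← Matrix.mul_assoc (W.map _), map_mul_map_inv hW, Matrix.one_mul,
    add_sub_cancel, Matrix.mul_assoc, map_mul_map_inv hT, Matrix.mul_one]

variable (W T Q) in
/-- The substitution of `feedbackInvolution` into polynomials. -/
def feedbackSubstitution :
    MvPolynomial (Fin m × Fin m) ℂ →ₐ[ℂ] MvPolynomial (Fin m × Fin m) ℂ :=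
  MvPolynomial.aeval fun ij =>
    feedbackInvolution W T Q (Matrix.mvPolynomialX (Fin m) (Fin m) ℂ) ij.1 ij.2

theorem mvPolynomialX_map_feedbackSubstitution :
    (Matrix.mvPolynomialX (Fin m) (Fin m) ℂ).map (feedbackSubstitution W T Q) =
      feedbackInvolution W T Q (Matrix.mvPolynomialX (Fin m) (Fin m) ℂ) := by
  ext1 i j
  simp [feedbackSubstitution]

theorem feedbackSubstitution_comp_self (hW : IsUnit W.det) (hT : IsUnit T.det) :
    (feedbackSubstitution W T Q).comp (feedbackSubstitution W T Q) = AlgHom.id ℂ _ := by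
  refine MvPolynomial.algHom_ext fun ij => ?_
  have h := map_feedbackInvolution W T Q (feedbackSubstitution W T Q)
    (Matrix.mvPolynomialX (Fin m) (Fin m) ℂ)
  rw [mvPolynomialX_map_feedbackSubstitution, feedbackInvolution_involutive hW hT] at h
  have h1 := congrFun (congrFun h ij.1) ij.2
  simpa [feedbackSubstitution] using h1

theorem eval_feedbackSubstitution (a : MvPolynomial (Fin m × Fin m) ℂ)
    (K : Matrix (Fin m) (Fin m) ℂ) :
    MvPolynomial.eval (fun ij => K ij.1 ij.2) (feedbackSubstitution W T Q a) =
      MvPolynomial.eval (fun ij => feedbackInvolution W T Q K ij.1 ij.2) a := by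
  have h : (MvPolynomial.aeval (R := ℂ) fun ij : Fin m × Fin m => K ij.1 ij.2).comp
      (feedbackSubstitution W T Q) =
        MvPolynomial.aeval fun ij => feedbackInvolution W T Q K ij.1 ij.2 := by
    refine MvPolynomial.algHom_ext fun ij => ?_
    have h1 := map_feedbackInvolution W T Q
      (MvPolynomial.aeval (R := ℂ) fun ij : Fin m × Fin m => K ij.1 ij.2)
      (Matrix.mvPolynomialX (Fin m) (Fin m) ℂ)
    have h2 : (Matrix.mvPolynomialX (Fin m) (Fin m) ℂ).map
        (MvPolynomial.aeval (R := ℂ) fun ij : Fin m × Fin m => K ij.1 ij.2) = K := by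
      ext i j
      simp
    rw [h2] at h1
    rw [AlgHom.comp_apply, feedbackSubstitution, MvPolynomial.aeval_X, MvPolynomial.aeval_X, ← h1]
    rfl
  exact DFunLike.congr_fun h a

variable (Q) in
/-- The involution of the function field of the Grassmannian induced by `feedbackInvolution`. -/
def feedbackAlgEquiv (hW : IsUnit W.det) (hT : IsUnit T.det) :
    GrFunctionField m m ≃ₐ[ℂ] GrFunctionField m m :=
  IsFractionRing.algEquivOfAlgEquiv (R := ℂ) (AlgEquiv.ofAlgHom (feedbackSubstitution W T Q)
    (feedbackSubstitution W T Q) (feedbackSubstitution_comp_self hW hT)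
    (feedbackSubstitution_comp_self hW hT))

theorem feedbackAlgEquiv_algebraMap (hW : IsUnit W.det) (hT : IsUnit T.det)
    (a : MvPolynomial (Fin m × Fin m) ℂ) :
    feedbackAlgEquiv Q hW hT (algebraMap _ (GrFunctionField m m) a) =
      algebraMap _ (GrFunctionField m m) (feedbackSubstitution W T Q a) :=
  IsFractionRing.algEquivOfAlgEquiv_algebraMap _ _

theorem feedbackAlgEquiv_involutive (hW : IsUnit W.det) (hT : IsUnit T.det)
    (x : GrFunctionField m m) :
    feedbackAlgEquiv Q hW hT (feedbackAlgEquiv Q hW hT x) = x := by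
  have h : ∀ a : MvPolynomial (Fin m × Fin m) ℂ,
      feedbackAlgEquiv Q hW hT (feedbackAlgEquiv Q hW hT (algebraMap _ (GrFunctionField m m) a)) =
        algebraMap _ (GrFunctionField m m) a := by
    intro a
    rw [feedbackAlgEquiv_algebraMap, feedbackAlgEquiv_algebraMap, ← AlgHom.comp_apply,
      feedbackSubstitution_comp_self hW hT, AlgHom.id_apply]
  obtain ⟨a, b, -, hx⟩ := IsFractionRing.div_surjective (A := MvPolynomial (Fin m × Fin m) ℂ) x
  rw [← hx, map_div₀, map_div₀, h, h]

/-- The involution is conjugate to transposition by an affine change of `K`, and an off-diagonal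
matrix unit, available for `m ≥ 2`, is not symmetric. -/
theorem exists_feedbackAlgEquiv_ne (hW : IsUnit W.det) (hT : IsUnit T.det) (hm : 2 ≤ m) :
    ∃ x, feedbackAlgEquiv Q hW hT x ≠ x := by
  by_contra! hall
  have hfix : ∀ K : Matrix (Fin m) (Fin m) ℂ, feedbackInvolution W T Q K = K := by
    intro K
    ext i j
    have h := hall (algebraMap (MvPolynomial (Fin m × Fin m) ℂ) (GrFunctionField m m)
      (MvPolynomial.X (i, j)))
    rw [feedbackAlgEquiv_algebraMap] at h
    have h1 := eval_feedbackSubstitution (W := W) (T := T) (Q := Q) (MvPolynomial.X (i, j)) K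
    rw [IsFractionRing.injective _ _ h] at h1
    simpa using h1.symm
  have htr : ∀ K : Matrix (Fin m) (Fin m) ℂ, K.transpose = K := by
    intro K
    have h := (feedbackInvolution_apply (Q := Q) hW hT K).symm.trans (hfix _)
    have h2 := congrArg (fun X => W⁻¹ * (X * T - Q)) h
    simpa [Matrix.mul_assoc, Matrix.nonsing_inv_mul _ hT, Matrix.nonsing_inv_mul_cancel_left _ _ hW,
      Algebra.algebraMap_self] using h2
  have h01 := congrFun (congrFun (htr (Matrix.single ⟨0, by omega⟩ ⟨1, by omega⟩ 1)) ⟨0, by omega⟩)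
    ⟨1, by omega⟩
  simp [Matrix.single] at h01

theorem IsStateFeedback.polePlacement_feedbackInvolution {S S' : LinearSystem N m m}
    {L : Matrix (Fin N) (Fin N) ℂ} (h : S.IsStateFeedback S' L W T Q) (hS' : S'.IsSymmetric)
    (K : Matrix (Fin m) (Fin m) ℂ) :
    S.polePlacement (feedbackInvolution W T Q K) = S.polePlacement K := by
  have h1 : feedbackInvolution W T Q K = (Q + W * (W⁻¹ * (K * T - Q)).transpose) * T⁻¹ := by
    simp [feedbackInvolution, Algebra.algebraMap_self]
  have h2 : K = (Q + W * (W⁻¹ * (K * T - Q))) * T⁻¹ := by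
    rw [← Matrix.mul_assoc W, Matrix.mul_nonsing_inv _ h.isUnit_W, Matrix.one_mul, add_sub_cancel,
      Matrix.mul_assoc, Matrix.mul_nonsing_inv _ h.isUnit_T, Matrix.mul_one]
  rw [h1, h.polePlacement_eq, hS'.polePlacement_transpose, ← h.polePlacement_eq, ← h2]

theorem IsStateFeedback.feedbackAlgEquiv_eq_self {S S' : LinearSystem N m m}
    {L : Matrix (Fin N) (Fin N) ℂ} (h : S.IsStateFeedback S' L W T Q) (hS' : S'.IsSymmetric)
    {x : GrFunctionField m m} (hx : x ∈ imageFunctionField S.center) :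
    feedbackAlgEquiv Q h.isUnit_W h.isUnit_T x = x := by
  have hpull : ∀ l a, IsPullback S.center l a → feedbackSubstitution W T Q a = a := by
    intro l a ha
    refine MvPolynomial.funext fun x => ?_
    let K : Matrix (Fin m) (Fin m) ℂ := Matrix.of fun i j => x (i, j)
    refine (eval_feedbackSubstitution a K).trans ((ha _).trans ?_)
    -- Modulo `Z` the chart vector is determined by its pole placement polynomial, so every linear
    -- coordinate on the target is invariant.
    refine Eq.trans (congrArg l (S.polePlacementQuotient_injective ?_)) (ha K).symm
    rw [polePlacementQuotient_mkQ, polePlacementQuotient_mkQ, polePlacementLinear_chartVector,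
      polePlacementLinear_chartVector, h.polePlacement_feedbackInvolution hS']
  induction hx using IntermediateField.adjoin_induction with
  | mem x hx =>
    obtain ⟨l₁, l₂, a, b, ha, hb, -, rfl⟩ := hx
    rw [map_div₀, feedbackAlgEquiv_algebraMap, feedbackAlgEquiv_algebraMap, hpull _ _ ha,
      hpull _ _ hb]
  | algebraMap c => exact AlgEquiv.commutes _ c
  | add x y _ _ hx hy => rw [map_add, hx, hy]
  | inv x _ hx => rw [map_inv₀, hx]
  | mul x y _ _ hx hy => rw [map_mul, hx, hy]

end FeedbackInvolution

end LinearSystem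

end

theorem theorem3p2 {N m : ℕ} (S : LinearSystem N m m)
    (hcontr : S.IsControllable) (hobs : S.IsObservable)
    (hsymm : ∃ S' : LinearSystem N m m, S.StateFeedbackEquiv S' ∧ S'.IsSymmetric)
    (hproper : S.IsProper) :
    S.PolePlacementIsWronskiMap S.center ∧
      IsSelfAdjointCenter S.center ∧
      (2 ≤ m → ∃ d : ℕ, WronskiMapHasDegree S.center d ∧ Even d) := by
  obtain ⟨S', hS, hS'⟩ := hsymm
  refine ⟨S.polePlacementIsWronskiMap_center, LinearSystem.isSelfAdjointCenter_center hS hS',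
    fun hm => ?_⟩
  obtain ⟨L, W, T, Q, hL, hW, hT, hA, hB, hC⟩ := hS
  have h : S.IsStateFeedback S' L W T Q := ⟨hL, hW, hT, hA, hB, hC⟩
  have hfin := hproper.finiteDimensional
  exact ⟨_, ⟨hfin, rfl⟩, (imageFunctionField S.center).even_finrank_of_involution
    (LinearSystem.feedbackAlgEquiv Q hW hT) (fun x hx => h.feedbackAlgEquiv_eq_self hS' hx)
    (LinearSystem.feedbackAlgEquiv_involutive hW hT)
    (LinearSystem.exists_feedbackAlgEquiv_ne hW hT hm)⟩
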